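/- Let $\mathbb I=[0,1]$. A copula is a function $C:\mathbb I^2\to\mathbb R$ with $C(a,0)=C(0,b)=0$, $C(a,1)=a$, $C(1,b)=b$ that is 2-increasing; a quasi-copula satisfies the same boundary conditions, is increasing in each variable and 1-Lipschitz for the $\ell^1$ distance (it is proper if it is not a copula). Put $W(a,b)=\max\{0,a+b-1\}$, $M(a,b)=\min\{a,b\}$, $\widehat Q(a,b)=a+b-1+Q(1-a,1-b)$, and for every quasi-copula $Q$ let $$\gamma(Q)=4\int_0^1\bigl(Q(t,t)+Q(t,1-t)\bigr)\,dt-2$$ (Gini's gamma). For $\gamma\in[-1,1]$ let $\underline G_\gamma$ be the pointwise infimum of all copulas $C$ with $\gamma(C)=\gamma$. Let $$\omega_{a,b}(\gamma)=\tfrac12\Bigl(a+b-1+\tfrac{\sqrt3}{3}\sqrt{5(a+b-1)^2-2(1-2a)(1-2b)+2(1+\gamma)}\Bigr)$$ and let $R_\gamma=\{(a,b)\in\mathbb I^2:\ \omega_{a,1-b}(-\gamma)<a,\ \omega_{a,1-b}(-\gamma)<1-b\}$. Then: (i) $\underline G_1=M$, and $\underline G_\gamma=W$ for all $\gamma\in[-1,-\frac12]$.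 (ii) For every $\gamma\in(0,1)$, $\underline G_\gamma$ is a quasi-copula but not a copula. (iii) For every $\gamma\in(-\frac12,0]$, $\underline G_\gamma$ is a copula different from $W$ and $M$. The region $R_\gamma$ is nonempty and connected, and its boundary $\partial R_\gamma$ lies on the hyperbolas $\omega_{a,1-b}(-\gamma)=a$ and $\omega_{a,1-b}(-\gamma)=1-b$. The probability measure on $\mathbb I^2$ induced by $\underline G_\gamma$ has a nonzero singular component with respect to Lebesgue measure. Its absolutely continuous component is concentrated on $R_\gamma$ and has support $\overline{R_\gamma}$. Its singular component is concentrated on, and has support equal to, the union of $\partial R_\gamma$ and the part of the anti-diagonal $a+b=1$ outside $R_\gamma$ (two segments). (iv) $\underline G_\gamma$ is increasing in $\gamma$ in the concordance order: if $-1\le\gamma\le\gamma'\le1$, then $\underline G_\gamma\le\underline G_{\gamma'}$ and $\widehat{\underline G}_\gamma\le\widehat{\underline G}_{\gamma'}$ pointwise. (v) For every $\gamma\in[-1,1]$, $\underline G_\gamma(a,b)=\underline G_\gamma(b,a)$ and $\underline G_\gamma=\widehat{\underline G}_\gamma$. (vi) $\gamma(\underline G_\gamma)<\gamma$ for all $\gamma\in(-1,1)$.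 -/

import Mathlib

open MeasureTheory unitInterval

noncomputable section

/-- A bivariate copula: a function on the unit square that is grounded, has uniform margins
and is 2-increasing. -/
structure IsCopula (C : I → I → ℝ) : Prop where
  zero_left : ∀ b, C 0 b = 0
  zero_right : ∀ a, C a 0 = 0
  one_left : ∀ b, C 1 b = b
  one_right : ∀ a, C a 1 = a
  two_increasing : ∀ a a' b b', a ≤ a' → b ≤ b' → 0 ≤ C a' b' - C a b' - C a' b + C a b

/-- A bivariate quasi-copula: a function on the unit square that is grounded, has uniform margins,
is increasing in each variable and is 1-Lipschitz with respect to the `ℓ¹` distance. -/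
structure IsQuasiCopula (Q : I → I → ℝ) : Prop where
  zero_left : ∀ b, Q 0 b = 0
  zero_right : ∀ a, Q a 0 = 0
  one_left : ∀ b, Q 1 b = b
  one_right : ∀ a, Q a 1 = a
  mono : ∀ a a' b b', a ≤ a' → b ≤ b' → Q a b ≤ Q a' b'
  lipschitz : ∀ a a' b b', |Q a b - Q a' b'| ≤ |(a : ℝ) - a'| + |(b : ℝ) - b'|

/-- The Fréchet-Hoeffding lower bound `W(a, b) = max {0, a + b - 1}`. -/
def frechetW (a b : I) : ℝ := max 0 ((a : ℝ) + b - 1)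

/-- The Fréchet-Hoeffding upper bound `M(a, b) = min {a, b}`. -/
def frechetM (a b : I) : ℝ := min (a : ℝ) b

/-- The first reflection `(a, b) ↦ b - C(1 - a, b)`. -/
def reflect₁ (C : I → I → ℝ) (a b : I) : ℝ := b - C (σ a) b

/-- The second reflection `(a, b) ↦ a - C(a, 1 - b)`. -/
def reflect₂ (C : I → I → ℝ) (a b : I) : ℝ := a - C a (σ b)

/-- The survival function `Ĉ`, obtained from `C` by the two reflections. -/
def survival (C : I → I → ℝ) : I → I → ℝ := reflect₂ (reflect₁ C)

/-- The concordance order: `C ≤ D` and `Ĉ ≤ D̂` pointwise. -/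
def ConcordanceLE (C D : I → I → ℝ) : Prop :=
  (∀ a b, C a b ≤ D a b) ∧ ∀ a b, survival C a b ≤ survival D a b

/-- Gini's gamma, `4 ∫₀¹ (Q(t, t) + Q(t, 1 - t)) dt - 2`, for copulas and quasi-copulas. -/
def giniGamma (Q : I → I → ℝ) : ℝ := 4 * (∫ t : I, (Q t t + Q t (σ t))) - 2

/-- The pointwise infimum of the set of all copulas whose Gini's gamma equals `γ`. -/
def giniLower (γ : ℝ) (a b : I) : ℝ :=
  sInf {x : ℝ | ∃ C : I → I → ℝ, IsCopula C ∧ giniGamma C = γ ∧ C a b = x}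

/-- The function `ω_{a,b}(γ)`; for fixed `γ` the equations `ω_{a,b}(γ) = a` and
`ω_{a,b}(γ) = b` describe arcs of hyperbolas. -/
def omegaFun (a b γ : ℝ) : ℝ :=
  1 / 2 * (a + b - 1 + √3 / 3 *
    √(5 * (a + b - 1) ^ 2 - 2 * (1 - 2 * a) * (1 - 2 * b) + 2 * (1 + γ)))

/-- The arc `ω_{a,1-b}(-γ) = a` in the unit square. -/
def hyperbola₁ (γ : ℝ) : Set (I × I) :=
  {p | omegaFun p.1 (1 - p.2) (-γ) = p.1}

/-- The arc `ω_{a,1-b}(-γ) = 1 - b` in the unit square. -/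
def hyperbola₂ (γ : ℝ) : Set (I × I) :=
  {p | omegaFun p.1 (1 - p.2) (-γ) = 1 - p.2}

/-- The region of the unit square between the two arcs. -/
def hyperbolicRegion (γ : ℝ) : Set (I × I) :=
  {p | omegaFun p.1 (1 - p.2) (-γ) < p.1 ∧ omegaFun p.1 (1 - p.2) (-γ) < 1 - p.2}

/-- The anti-diagonal of the unit square. -/
def antiDiag : Set (I × I) := {p | (p.1 : ℝ) + p.2 = 1}

/-- `μ` is the (necessarily unique) Borel measure on the unit square with distribution
function `C`, i.e. the measure of `[0, a] × [0, b]` is `C(a, b)`. -/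
def IsCopulaMeasure (C : I → I → ℝ) (μ : Measure (I × I)) : Prop :=
  ∀ a b : I, μ (Set.Iic a ×ˢ Set.Iic b) = ENNReal.ofReal (C a b)

/-- The absolutely continuous component of `μ` in its Lebesgue decomposition. -/
def acPart (μ : Measure (I × I)) : Measure (I × I) :=
  (volume : Measure (I × I)).withDensity (μ.rnDeriv volume)

end

section Basic

/-! ### Copulas and quasi-copulas -/

/-! Among all copulas with value `d` at a point `(a, b)` there is a largest one, `upperCopula a b
d`, and Gini's gamma is monotone. Mixing a copula with `W` lowers gamma continuously to `-1` while
only decreasing the copula, so prescribing `γ` or requiring at least `γ` gives the same infimum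
(`exists_isCopula_le`). Hence `giniLower γ a b` is the least admissible `d` for which `upperCopula a
b d` has gamma at least `γ`.

For `a ≤ b`, `a + b ≤ 1`, `d ≤ 2a + b - 1`, that gamma is `1 + (a+b-1)² - 6(a-d)(b-d)`
(`giniGamma_upperCopula`). Equating it to `γ` is a quadratic equation in `d` whose smaller root is
`sheet γ a b`. Transposition and survival preserve gamma and carry this triangle to the rest of the
square. For `γ ≤ 0` the restriction on `d` is harmless (`sheet_le_max`), so the infimum is `max W
sheet` (`giniLower_eq`). Since `ω_{a,1-b}(-γ) = a - sheet γ a b`, the region `R_γ` is the set where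
`sheet` exceeds `W`.

For `γ ≤ 0` the mixed derivative of `sheet` is positive on `R_γ`, and its slope in the first
variable lies strictly between 0 and 1. Integrating over vertical slices exhibits the infimum as the
distribution function of an explicit measure: a positive density on `R_γ` plus positive mass on the
graphs of two arcs, which merge into the antidiagonal outside `R_γ`. So it is a copula, and the
Lebesgue decomposition can be read off. For `0 < γ < 1` the mixed derivative is negative at some
antidiagonal point with `sheet > 0`, and a small square there has negative volume.

The order, symmetry and survival claims follow from the infimum description; strictness in (vi)
comes from comparing with a mixture of `M` and `W` at the centre. -/

theorem integral_unitInterval_eq (f : ℝ → ℝ) : ∫ t : I, f t = ∫ t in (0 : ℝ)..1, f t := by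
  rw [intervalIntegral.integral_of_le zero_le_one, ← integral_Icc_eq_integral_Ioc]
  exact integral_subtype_comap measurableSet_Icc f

instance isOpenPosMeasure_unitInterval : Measure.IsOpenPosMeasure (volume : Measure I) where
  open_pos := by
    rintro U hU ⟨x, hx⟩
    obtain ⟨V, hV, rfl⟩ := isOpen_induced_iff.1 hU
    have hcl : (x : ℝ) ∈ closure (Set.Ioo (0 : ℝ) 1) := by
      rw [closure_Ioo zero_ne_one]
      exact x.2
    have hne : (V ∩ Set.Ioo (0 : ℝ) 1).Nonempty := mem_closure_iff.1 hcl V hV hx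
    have hpos := (hV.inter isOpen_Ioo).measure_pos volume hne
    refine ne_of_gt (hpos.trans_le ?_)
    rw [volume_apply, Subtype.image_preimage_coe]
    exact measure_mono fun y hy ↦ ⟨Set.Ioo_subset_Icc_self hy.2, hy.1⟩

namespace IsCopula

variable {C D : I → I → ℝ}

theorem mono_left (h : IsCopula C) {a a' : I} (b : I) (haa : a ≤ a') : C a b ≤ C a' b := by
  have := h.two_increasing a a' 0 b haa nonneg'
  rw [h.zero_right, h.zero_right] at this
  linarith

theorem mono_right (h : IsCopula C) (a : I) {b b' : I} (hbb : b ≤ b') : C a b ≤ C a b' := by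
  have := h.two_increasing 0 a b b' nonneg' hbb
  rw [h.zero_left, h.zero_left] at this
  linarith

theorem lipschitz_left (h : IsCopula C) {a a' : I} (b : I) (haa : a ≤ a') :
    C a' b - C a b ≤ a' - a := by
  have := h.two_increasing a a' b 1 haa le_one'
  rw [h.one_right, h.one_right] at this
  linarith

theorem abs_sub_left (h : IsCopula C) (a a' b : I) : |C a b - C a' b| ≤ |(a : ℝ) - a'| := by
  rcases le_total a a' with haa | haa
  · have h₁ := h.mono_left b haa
    have h₂ := h.lipschitz_left b haa
    have h₃ : (a : ℝ) ≤ a' := haa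
    rw [abs_le, abs_of_nonpos (by linarith)]
    constructor <;> linarith
  · have h₁ := h.mono_left b haa
    have h₂ := h.lipschitz_left b haa
    have h₃ : (a' : ℝ) ≤ a := haa
    rw [abs_le, abs_of_nonneg (a := (a : ℝ) - a') (by linarith)]
    constructor <;> linarith

/-- The transpose of a copula is a copula. -/
theorem swap (h : IsCopula C) : IsCopula fun a b ↦ C b a where
  zero_left := h.zero_right
  zero_right := h.zero_left
  one_left := h.one_right
  one_right := h.one_left
  two_increasing a a' b b' ha hb := by
    have := h.two_increasing b b' a a' hb ha
    linarith

theorem abs_sub_right (h : IsCopula C) (a b b' : I) : |C a b - C a b'| ≤ |(b : ℝ) - b'| :=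
  h.swap.abs_sub_left b b' a

theorem isQuasiCopula (h : IsCopula C) : IsQuasiCopula C where
  zero_left := h.zero_left
  zero_right := h.zero_right
  one_left := h.one_left
  one_right := h.one_right
  mono a a' b b' ha hb := (h.mono_left b ha).trans (h.mono_right a' hb)
  lipschitz a a' b b' := by
    have h₁ := abs_sub_le (C a b) (C a' b) (C a' b')
    have h₂ := h.abs_sub_left a a' b
    have h₃ := h.abs_sub_right a' b b'
    linarith

end IsCopula

namespace IsQuasiCopula

variable {Q : I → I → ℝ}

theorem continuous (h : IsQuasiCopula Q) : Continuous fun p : I × I ↦ Q p.1 p.2 := by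
  have hl : LipschitzWith 2 fun p : I × I ↦ Q p.1 p.2 := by
    refine LipschitzWith.of_dist_le_mul fun p q ↦ ?_
    have h₁ : |(p.1 : ℝ) - q.1| ≤ dist p q := le_max_left _ _
    have h₂ : |(p.2 : ℝ) - q.2| ≤ dist p q := le_max_right _ _
    have h₃ := h.lipschitz p.1 q.1 p.2 q.2
    rw [Real.dist_eq]
    push_cast
    linarith
  exact hl.continuous

theorem continuous_diag (h : IsQuasiCopula Q) : Continuous fun t : I ↦ Q t t + Q t (σ t) :=
  (h.continuous.comp (continuous_id.prodMk continuous_id)).add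
    (h.continuous.comp (continuous_id.prodMk continuous_symm))

theorem integrable_diag (h : IsQuasiCopula Q) :
    Integrable fun t : I ↦ Q t t + Q t (σ t) :=
  h.continuous_diag.integrable_of_hasCompactSupport (HasCompactSupport.of_compactSpace _)

theorem nonneg (h : IsQuasiCopula Q) (a b : I) : 0 ≤ Q a b := by
  have := h.mono 0 a b b nonneg' le_rfl
  rwa [h.zero_left] at this

theorem frechetW_le (h : IsQuasiCopula Q) (a b : I) : frechetW a b ≤ Q a b := by
  refine max_le (h.nonneg a b) ?_
  have h₁ := h.lipschitz 1 a b b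
  rw [h.one_left, sub_self, abs_zero, add_zero, Set.Icc.coe_one,
    abs_of_nonneg (a := 1 - (a : ℝ)) (by linarith [a.2.2])] at h₁
  linarith [le_abs_self ((b : ℝ) - Q a b)]

theorem le_frechetM (h : IsQuasiCopula Q) (a b : I) : Q a b ≤ frechetM a b := by
  refine le_min ?_ ?_
  · have := h.mono a a b 1 le_rfl le_one'
    rwa [h.one_right] at this
  · have := h.mono a 1 b b le_one' le_rfl
    rwa [h.one_left] at this

theorem giniGamma_mono {Q' : I → I → ℝ} (h : IsQuasiCopula Q) (h' : IsQuasiCopula Q')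
    (hle : ∀ a b, Q a b ≤ Q' a b) : giniGamma Q ≤ giniGamma Q' := by
  have := integral_mono h.integrable_diag h'.integrable_diag
    fun t ↦ add_le_add (hle t t) (hle t (σ t))
  unfold giniGamma
  linarith

/-- The integrand of the difference is continuous and nonnegative, so positivity at one diagonal
point suffices. This gives rigidity at `γ = 1` and strictness in (vi). -/
theorem giniGamma_lt {Q' : I → I → ℝ} (h : IsQuasiCopula Q) (h' : IsQuasiCopula Q')
    (hle : ∀ a b, Q a b ≤ Q' a b) (t : I) (ht : Q t t < Q' t t) : giniGamma Q < giniGamma Q' := by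
  have hc : Continuous fun t : I ↦ (Q' t t + Q' t (σ t)) - (Q t t + Q t (σ t)) :=
    h'.continuous_diag.sub h.continuous_diag
  have : 0 < ∫ t : I, ((Q' t t + Q' t (σ t)) - (Q t t + Q t (σ t))) := by
    refine hc.integral_pos_of_hasCompactSupport_nonneg_nonzero
      (HasCompactSupport.of_compactSpace _) (fun t ↦ ?_) (x := t) ?_
    · have h₁ := hle t t
      have h₂ := hle t (σ t)
      simp only [Pi.zero_apply]
      linarith
    · have h₂ := hle t (σ t)
      simp only [ne_eq]
      exact ne_of_gt (by linarith)
  rw [integral_sub h'.integrable_diag h.integrable_diag] at this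
  unfold giniGamma
  linarith

end IsQuasiCopula

/-- The function `min` is itself 2-increasing. The verifications for `frechetM`, `frechetW` and
`upperCopula` all reduce to this. -/
theorem min_add_min_le {x x' y y' : ℝ} (hx : x ≤ x') (hy : y ≤ y') :
    min x' y + min x y' ≤ min x' y' + min x y := by
  rcases le_total x y with h₁ | h₁ <;> rcases le_total x' y' with h₂ | h₂ <;>
    rcases le_total x' y with h₃ | h₃ <;> rcases le_total x y' with h₄ | h₄ <;>
    simp only [min_eq_left, min_eq_right, h₁, h₂, h₃, h₄] <;> linarith

theorem isCopula_frechetM : IsCopula frechetM where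
  zero_left b := min_eq_left b.2.1
  zero_right a := min_eq_right a.2.1
  one_left b := min_eq_right b.2.2
  one_right a := min_eq_left a.2.2
  two_increasing a a' b b' ha hb := by
    have := min_add_min_le (x := (a : ℝ)) (x' := a') (y := b) (y' := b') ha hb
    simp only [frechetM]
    linarith

theorem isCopula_frechetW : IsCopula frechetW where
  zero_left b := max_eq_left (by simpa using b.2.2)
  zero_right a := max_eq_left (by simpa using a.2.2)
  one_left b := by
    rw [frechetW, max_eq_right] <;> simp [b.2.1]
  one_right a := by
    rw [frechetW, max_eq_right] <;> simp [a.2.1]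
  two_increasing a a' b b' ha hb := by
    have h₁ : (a : ℝ) ≤ a' := ha
    have h₂ : (b : ℝ) ≤ b' := hb
    have := min_add_min_le (x := (a : ℝ)) (x' := a') (y := 1 - b') (y' := 1 - b) h₁ (by linarith)
    have key : ∀ x y : I, frechetW x y = x - min (x : ℝ) (1 - y) := by
      intro x y
      rw [frechetW, sub_eq_add_neg (x : ℝ), ← max_neg_neg, ← max_add_add_left]
      ring_nf
    simp only [key]
    linarith

theorem IsCopula.convexComb {C D : I → I → ℝ} (hC : IsCopula C) (hD : IsCopula D) {l : ℝ}
    (hl : 0 ≤ l) (hl' : l ≤ 1) : IsCopula fun a b ↦ l * C a b + (1 - l) * D a b where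
  zero_left b := by rw [hC.zero_left, hD.zero_left]; ring
  zero_right b := by rw [hC.zero_right, hD.zero_right]; ring
  one_left b := by rw [hC.one_left, hD.one_left]; ring
  one_right b := by rw [hC.one_right, hD.one_right]; ring
  two_increasing a a' b b' ha hb := by
    have h₁ := mul_nonneg hl (hC.two_increasing a a' b b' ha hb)
    have h₂ := mul_nonneg (sub_nonneg.2 hl') (hD.two_increasing a a' b b' ha hb)
    linarith

/-! ### Gini's gamma: affinity, values at the Fréchet-Hoeffding bounds, symmetries. -/

theorem giniGamma_convexComb {C D : I → I → ℝ} (hC : IsCopula C) (hD : IsCopula D) (l : ℝ) :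
    giniGamma (fun a b ↦ l * C a b + (1 - l) * D a b) =
      l * giniGamma C + (1 - l) * giniGamma D := by
  have : ∀ t : I, (l * C t t + (1 - l) * D t t) + (l * C t (σ t) + (1 - l) * D t (σ t)) =
      l * (C t t + C t (σ t)) + (1 - l) * (D t t + D t (σ t)) := fun t ↦ by ring
  simp only [giniGamma, this]
  rw [integral_add (hC.isQuasiCopula.integrable_diag.const_mul _)
    (hD.isQuasiCopula.integrable_diag.const_mul _), integral_const_mul, integral_const_mul]
  ring

theorem integral_const_add_linear (x y m n : ℝ) :
    ∫ t in x..y, (m + n * t) = m * (y - x) + n * (y ^ 2 - x ^ 2) / 2 := by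
  rw [intervalIntegral.integral_add (Continuous.intervalIntegrable (by fun_prop) _ _) (Continuous.intervalIntegrable (by fun_prop) _ _),
    intervalIntegral.integral_const_mul]
  simp
  ring

theorem integral_eq_of_eqOn_linear {f : ℝ → ℝ} {x y m n : ℝ} (hxy : x ≤ y)
    (h : ∀ t ∈ Set.Icc x y, f t = m + n * t) :
    ∫ t in x..y, f t = m * (y - x) + n * (y ^ 2 - x ^ 2) / 2 := by
  rw [← integral_const_add_linear]
  refine intervalIntegral.integral_congr fun t ht ↦ h t ?_
  rwa [Set.uIcc_of_le hxy] at ht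

theorem integral_min_one_sub : ∫ t in (0 : ℝ)..1, min t (1 - t) = 1 / 4 := by
  have hc : Continuous fun t : ℝ ↦ min t (1 - t) := by fun_prop
  rw [← intervalIntegral.integral_add_adjacent_intervals (b := 1 / 2)
    (hc.intervalIntegrable _ _) (hc.intervalIntegrable _ _),
    integral_eq_of_eqOn_linear (m := 0) (n := 1) (by norm_num),
    integral_eq_of_eqOn_linear (m := 1) (n := -1) (by norm_num)]
  · norm_num
  · rintro t ⟨h₁, h₂⟩
    rw [min_eq_right (by linarith)]; ring
  · rintro t ⟨h₁, h₂⟩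
    rw [min_eq_left (by linarith)]; ring

theorem giniGamma_frechetM : giniGamma frechetM = 1 := by
  have h₁ : ∀ t : I, frechetM t t + frechetM t (σ t) =
      (fun s : ℝ ↦ s + min s (1 - s)) t := fun t ↦ by simp [frechetM]
  simp only [giniGamma, h₁]
  rw [integral_unitInterval_eq (fun s : ℝ ↦ s + min s (1 - s)),
    intervalIntegral.integral_add (Continuous.intervalIntegrable (by fun_prop) _ _) (Continuous.intervalIntegrable (by fun_prop) _ _),
    integral_min_one_sub]
  simp
  norm_num

theorem giniGamma_frechetW : giniGamma frechetW = -1 := by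
  have h₁ : ∀ t : I, frechetW t t + frechetW t (σ t) = (fun s : ℝ ↦ s - min s (1 - s)) t := by
    intro t
    have h₀ : frechetW t (σ t) = 0 := by simp [frechetW]
    rw [h₀, frechetW]
    change _ = (t : ℝ) - min (t : ℝ) (1 - t)
    rw [sub_eq_add_neg (t : ℝ), ← max_neg_neg, ← max_add_add_left]
    ring_nf
  simp only [giniGamma, h₁]
  rw [integral_unitInterval_eq (fun s : ℝ ↦ s - min s (1 - s)),
    intervalIntegral.integral_sub (Continuous.intervalIntegrable (by fun_prop) _ _) (Continuous.intervalIntegrable (by fun_prop) _ _),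
    integral_min_one_sub]
  simp
  norm_num

theorem survival_apply (C : I → I → ℝ) (a b : I) :
    survival C a b = a + b - 1 + C (σ a) (σ b) := by
  simp only [survival, reflect₁, reflect₂, coe_symm_eq]
  ring

theorem IsCopula.survival {C : I → I → ℝ} (h : IsCopula C) : IsCopula (survival C) where
  zero_left b := by simp [survival_apply, h.one_left]
  zero_right a := by simp [survival_apply, h.one_right]
  one_left b := by simp [survival_apply, h.zero_left]
  one_right a := by simp [survival_apply, h.zero_right]
  two_increasing a a' b b' ha hb := by
    have := h.two_increasing (σ a') (σ a) (σ b') (σ b) (symm_le_symm.2 ha) (symm_le_symm.2 hb)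
    simp only [survival_apply]
    linarith

theorem integral_comp_symm (f : I → ℝ) : ∫ t : I, f (σ t) = ∫ t : I, f t :=
  measurePreserving_symm.integral_comp symmMeasurableEquiv.measurableEmbedding f

/-- The substitution `t ↦ 1 - t` restores the integrand of `C` up to the term `2t - 1`, which
integrates to zero. -/
theorem IsCopula.giniGamma_survival {C : I → I → ℝ} (h : IsCopula C) :
    giniGamma (_root_.survival C) = giniGamma C := by
  have hc := h.isQuasiCopula.continuous
  have hi : ∀ {f : I → ℝ}, Continuous f → Integrable f := fun hf ↦
    hf.integrable_of_hasCompactSupport (HasCompactSupport.of_compactSpace _)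
  have h₁ : ∀ t : I, _root_.survival C t t + _root_.survival C t (σ t) =
      (2 * (t : ℝ) - 1) + (C (σ t) (σ t) + C (σ t) (σ (σ t))) := fun t ↦ by
    simp only [survival_apply, coe_symm_eq]; ring
  have h₂ : ∫ t : I, (2 * (t : ℝ) - 1) = 0 := by
    rw [integral_unitInterval_eq fun t ↦ 2 * t - 1,
      integral_eq_of_eqOn_linear (m := -1) (n := 2) zero_le_one (fun t _ ↦ by ring)]
    norm_num
  simp only [giniGamma, h₁]
  rw [integral_add (hi (by fun_prop)) (hi (f := fun t ↦ C (σ t) (σ t) + C (σ t) (σ (σ t)))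
      (h.isQuasiCopula.continuous_diag.comp continuous_symm)),
    h₂, integral_comp_symm fun t ↦ C t t + C t (σ t)]
  ring

theorem IsCopula.giniGamma_swap {C : I → I → ℝ} (h : IsCopula C) :
    giniGamma (fun a b ↦ C b a) = giniGamma C := by
  have hc := h.isQuasiCopula.continuous
  have hi : ∀ {f : I → ℝ}, Continuous f → Integrable f := fun hf ↦
    hf.integrable_of_hasCompactSupport (HasCompactSupport.of_compactSpace _)
  have hd : Integrable fun t : I ↦ C t t := hi (hc.comp (continuous_id.prodMk continuous_id))
  have ha : Continuous fun t : I ↦ C t (σ t) := hc.comp (continuous_id.prodMk continuous_symm)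
  have hb := hi (ha.comp continuous_symm)
  simp only [Function.comp_def, symm_symm] at hb
  have := integral_comp_symm fun t ↦ C t (σ t)
  simp only [symm_symm] at this
  simp only [giniGamma]
  rw [integral_add hd (hi ha), integral_add hd hb, this]

end Basic

section Infimum

/-! ### The upper copula through a point -/

/-- The largest copula with value `d` at the point `(a, b)`. -/
def upperCopula (a b d : ℝ) (u v : I) : ℝ :=
  min (min (u : ℝ) v) (d + max ((u : ℝ) - a) 0 + max ((v : ℝ) - b) 0)

theorem nonneg_of_split {F : I → ℝ} (m : I) (h₁ : ∀ a a', a ≤ a' → a' ≤ m → F a ≤ F a')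
    (h₂ : ∀ a a', m ≤ a → a ≤ a' → F a ≤ F a') {a a' : I} (h : a ≤ a') : F a ≤ F a' := by
  rcases le_total a' m with ha' | ha'
  · exact h₁ _ _ h ha'
  rcases le_total m a with ha | ha
  · exact h₂ _ _ ha h
  · exact (h₁ _ _ ha le_rfl).trans (h₂ _ _ le_rfl ha')

/-- The lines `u = a` and `v = b` cut the square into four rectangles. On each, the function is a
`min` of an increasing function of `u` and an increasing function of `v`, up to a summand in `v`
alone. `nonneg_of_split`, applied in each variable, glues the rectangles. -/
theorem upperCopula_two_increasing {a b : I} {d : ℝ} (ha : d ≤ a) (hb : d ≤ b)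
    {u u' v v' : I} (hu : u ≤ u') (hv : v ≤ v') :
    0 ≤ upperCopula a b d u' v' - upperCopula a b d u v' - upperCopula a b d u' v +
      upperCopula a b d u v := by
  have hsw : ∀ {a b : I} {d : ℝ} (u v : I), upperCopula a b d u v = upperCopula b a d v u := by
    intro a b d u v
    simp only [upperCopula, min_comm (u : ℝ) v]
    ring_nf
  have h₁₁ : ∀ u v : I, u ≤ a → v ≤ b → upperCopula a b d u v = min (min (u : ℝ) d) v := by
    intro u v h h'
    have h : (u : ℝ) ≤ a := h
    have h' : (v : ℝ) ≤ b := h'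
    rw [upperCopula, max_eq_right (by linarith), max_eq_right (by linarith), add_zero, add_zero,
      min_right_comm]
  have h₂₁ : ∀ {a b : I}, d ≤ a → ∀ u v : I, a ≤ u → v ≤ b →
      upperCopula a b d u v = min (d + (u - a)) v := by
    intro a b ha u v h h'
    have h : (a : ℝ) ≤ u := h
    have h' : (v : ℝ) ≤ b := h'
    rw [upperCopula, max_eq_left (by linarith), max_eq_right (by linarith), add_zero,
      min_right_comm, min_eq_right (a := (u : ℝ)) (by linarith)]
  have h₂₂ : ∀ u v : I, a ≤ u → b ≤ v → upperCopula a b d u v =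
      v - max (v : ℝ) (a + b - d) + min (u : ℝ) (max (v : ℝ) (a + b - d)) := by
    intro u v h h'
    have h : (a : ℝ) ≤ u := h
    have h' : (b : ℝ) ≤ v := h'
    rw [upperCopula, max_eq_left (by linarith), max_eq_left (by linarith),
      show d + ((u : ℝ) - a) + (v - b) = u + v - (a + b - d) by ring]
    generalize (a : ℝ) + b - d = k
    rcases le_total (v : ℝ) k with h₁ | h₁ <;> rcases le_total (u : ℝ) v with h₂ | h₂ <;>
      rcases le_total (u : ℝ) k with h₃ | h₃ <;>
      simp only [max_eq_left, max_eq_right, min_eq_left, min_eq_right, h₁, h₂, h₃] <;>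
      first
      | (rw [min_eq_left (by linarith)]; linarith)
      | (rw [min_eq_right (by linarith)]; linarith)
  suffices h : upperCopula a b d u v' - upperCopula a b d u v ≤
      upperCopula a b d u' v' - upperCopula a b d u' v by linarith
  refine nonneg_of_split (F := fun u ↦ upperCopula a b d u v' - upperCopula a b d u v) a
    (fun u u' hu hua ↦ ?_) (fun u u' hua hu ↦ ?_) hu
  all_goals
    suffices h : upperCopula a b d u' v - upperCopula a b d u v ≤
        upperCopula a b d u' v' - upperCopula a b d u v' by
      linarith
    refine nonneg_of_split (F := fun v ↦ upperCopula a b d u' v - upperCopula a b d u v) b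
      (fun v v' hv hvb ↦ ?_) (fun v v' hvb hv ↦ ?_) hv
  · simp only [h₁₁ u v (hu.trans hua) (hv.trans hvb), h₁₁ u' v hua (hv.trans hvb),
      h₁₁ u v' (hu.trans hua) hvb, h₁₁ u' v' hua hvb]
    have := min_add_min_le (x := min (u : ℝ) d) (x' := min (u' : ℝ) d) (y := v) (y' := v')
      (min_le_min_right _ hu) hv
    linarith
  · simp only [hsw (a := a), h₂₁ hb v u hvb (hu.trans hua), h₂₁ hb v u' hvb hua,
      h₂₁ hb v' u (hvb.trans hv) (hu.trans hua), h₂₁ hb v' u' (hvb.trans hv) hua]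
    have h : (v : ℝ) ≤ v' := hv
    have := min_add_min_le (x := d + ((v : ℝ) - b)) (x' := d + ((v' : ℝ) - b)) (y := u) (y' := u')
      (by linarith) hu
    linarith
  · simp only [h₂₁ ha u v hua (hv.trans hvb), h₂₁ ha u' v (hua.trans hu) (hv.trans hvb),
      h₂₁ ha u v' hua hvb, h₂₁ ha u' v' (hua.trans hu) hvb]
    have h : (u : ℝ) ≤ u' := hu
    have := min_add_min_le (x := d + ((u : ℝ) - a)) (x' := d + ((u' : ℝ) - a)) (y := v) (y' := v')
      (by linarith) hv
    linarith
  · simp only [h₂₂ u v hua hvb, h₂₂ u' v (hua.trans hu) hvb,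
      h₂₂ u v' hua (hvb.trans hv), h₂₂ u' v' (hua.trans hu) (hvb.trans hv)]
    have := min_add_min_le (x := (u : ℝ)) (x' := u') (y := max (v : ℝ) (a + b - d))
      (y' := max (v' : ℝ) (a + b - d)) hu (max_le_max_right _ hv)
    linarith

theorem isCopula_upperCopula {a b : I} {d : ℝ} (h₀ : 0 ≤ d) (h₁ : (a : ℝ) + b - 1 ≤ d)
    (ha : d ≤ a) (hb : d ≤ b) : IsCopula (upperCopula a b d) where
  zero_left v := by
    rw [upperCopula, Set.Icc.coe_zero, min_eq_left v.2.1, min_eq_left (by positivity)]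
  zero_right u := by
    rw [upperCopula, Set.Icc.coe_zero, min_eq_right u.2.1, min_eq_left (by positivity)]
  one_left v := by
    rw [upperCopula, Set.Icc.coe_one, min_eq_right v.2.2, min_eq_left]
    linarith [le_max_left (1 - (a : ℝ)) 0, le_max_left ((v : ℝ) - b) 0]
  one_right u := by
    rw [upperCopula, Set.Icc.coe_one, min_eq_left u.2.2, min_eq_left]
    linarith [le_max_left (1 - (b : ℝ)) 0, le_max_left ((u : ℝ) - a) 0]
  two_increasing _ _ _ _ hu hv := upperCopula_two_increasing ha hb hu hv

theorem upperCopula_self {a b : I} {d : ℝ} (ha : d ≤ a) (hb : d ≤ b) :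
    upperCopula a b d a b = d := by
  simp [upperCopula, ha, hb]

/-- Increase `(u, v)` to `(max u a, max v b)` by monotonicity, then return to `(a, b)` by the
Lipschitz bound. -/
theorem IsQuasiCopula.le_upperCopula {Q : I → I → ℝ} (h : IsQuasiCopula Q) (a b u v : I) :
    Q u v ≤ upperCopula a b (Q a b) u v := by
  refine le_min (h.le_frechetM u v) ?_
  have h₁ := h.mono u (max u a) v (max v b) (le_max_left _ _) (le_max_left _ _)
  have h₂ := (le_abs_self _).trans (h.lipschitz (max u a) a (max v b) b)
  have h₃ : ∀ x y : I, |((max x y : I) : ℝ) - y| = max ((x : ℝ) - y) 0 := by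
    intro x y
    rcases le_total x y with hxy | hxy
    · have h : (x : ℝ) ≤ y := hxy
      rw [max_eq_right hxy, max_eq_right (by linarith), sub_self, abs_zero]
    · have h : (y : ℝ) ≤ x := hxy
      rw [max_eq_left hxy, max_eq_left (by linarith), abs_of_nonneg (by linarith)]
  rw [h₃, h₃] at h₂
  linarith

/-- The integrand is piecewise linear with breakpoints `d ≤ a ≤ b ≤ a + b - d`. -/
theorem integral_upper_diag {a b d : ℝ} (h₀ : 0 ≤ d) (had : d ≤ a) (hab : a ≤ b)
    (h₁ : a + b - 1 ≤ d) :
    ∫ t in (0 : ℝ)..1, min t (d + max (t - a) 0 + max (t - b) 0) =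
      1 / 2 - (a - d) * (b - d) := by
  have hc : Continuous fun t : ℝ ↦ min t (d + max (t - a) 0 + max (t - b) 0) := by fun_prop
  have hi := fun x y : ℝ ↦ hc.intervalIntegrable (μ := volume) x y
  rw [← intervalIntegral.integral_add_adjacent_intervals (hi 0 d) (hi d 1),
    ← intervalIntegral.integral_add_adjacent_intervals (hi d a) (hi a 1),
    ← intervalIntegral.integral_add_adjacent_intervals (hi a b) (hi b 1),
    ← intervalIntegral.integral_add_adjacent_intervals (hi b (a + b - d)) (hi (a + b - d) 1),
    integral_eq_of_eqOn_linear (m := 0) (n := 1) h₀,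
    integral_eq_of_eqOn_linear (m := d) (n := 0) had,
    integral_eq_of_eqOn_linear (m := d - a) (n := 1) hab,
    integral_eq_of_eqOn_linear (m := d - a - b) (n := 2) (by linarith),
    integral_eq_of_eqOn_linear (m := 0) (n := 1) (by linarith)]
  · ring
  · rintro t ⟨h, h'⟩
    rw [max_eq_left (by linarith), max_eq_left (by linarith), min_eq_left (by linarith)]; ring
  · rintro t ⟨h, h'⟩
    rw [max_eq_left (by linarith), max_eq_left (by linarith), min_eq_right (by linarith)]; ring
  · rintro t ⟨h, h'⟩
    rw [max_eq_left (by linarith), max_eq_right (by linarith), min_eq_right (by linarith)]; ring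
  · rintro t ⟨h, h'⟩
    rw [max_eq_right (by linarith), max_eq_right (by linarith), min_eq_right (by linarith)]; ring
  · rintro t ⟨h, h'⟩
    rw [max_eq_right (by linarith), max_eq_right (by linarith), min_eq_left (by linarith)]; ring

/-- The breakpoints are `(d+1-b)/2`, `a`, `1-b`, `(1+a-d)/2`. The bound on `d` says exactly that the
first is at most `a`; together with `a ≤ b` it also orders the last two. -/
theorem integral_upper_antidiag {a b d : ℝ} (h₀ : 0 ≤ d) (hab : a ≤ b) (hs : a + b ≤ 1)
    (hd : d ≤ 2 * a + b - 1) :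
    ∫ t in (0 : ℝ)..1, min (min t (1 - t)) (d + max (t - a) 0 + max (1 - t - b) 0) =
      1 / 4 - (a - d) * (b - d) / 2 + (a + b - 1) ^ 2 / 4 := by
  have hc : Continuous fun t : ℝ ↦
    min (min t (1 - t)) (d + max (t - a) 0 + max (1 - t - b) 0) := by fun_prop
  have hi := fun x y : ℝ ↦ hc.intervalIntegrable (μ := volume) x y
  rw [← intervalIntegral.integral_add_adjacent_intervals (hi 0 ((d + 1 - b) / 2)) (hi _ 1),
    ← intervalIntegral.integral_add_adjacent_intervals (hi _ a) (hi a 1),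
    ← intervalIntegral.integral_add_adjacent_intervals (hi a (1 - b)) (hi _ 1),
    ← intervalIntegral.integral_add_adjacent_intervals (hi _ ((1 + a - d) / 2)) (hi _ 1),
    integral_eq_of_eqOn_linear (m := 0) (n := 1) (by linarith),
    integral_eq_of_eqOn_linear (m := d + 1 - b) (n := -1) (by linarith),
    integral_eq_of_eqOn_linear (m := d + 1 - b - a) (n := 0) (by linarith),
    integral_eq_of_eqOn_linear (m := d - a) (n := 1) (by linarith),
    integral_eq_of_eqOn_linear (m := 1) (n := -1) (by linarith)]
  · ring
  · rintro t ⟨h, h'⟩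
    rw [max_eq_left (by linarith), max_eq_right (by linarith), min_eq_right (a := t) (by linarith),
      min_eq_left (by linarith)]; ring
  · rintro t ⟨h, h'⟩
    rw [max_eq_left (by linarith), max_eq_right (by linarith),
      min_eq_right (le_min (by linarith) (by linarith))]; ring
  · rintro t ⟨h, h'⟩
    rw [max_eq_left (by linarith), max_eq_left (by linarith),
      min_eq_right (le_min (by linarith) (by linarith))]; ring
  · rintro t ⟨h, h'⟩
    rw [max_eq_right (by linarith), max_eq_left (by linarith),
      min_eq_right (le_min (by linarith) (by linarith))]; ring
  · rintro t ⟨h, h'⟩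
    rw [max_eq_right (by linarith), max_eq_left (by linarith), min_eq_left (a := t) (by linarith),
      min_eq_left (by linarith)]; ring

theorem giniGamma_upperCopula {a b : I} {d : ℝ} (h₀ : 0 ≤ d) (hab : a ≤ b)
    (hs : (a : ℝ) + b ≤ 1) (hd : d ≤ 2 * a + b - 1) :
    giniGamma (upperCopula a b d) =
      1 + ((a : ℝ) + b - 1) ^ 2 - 6 * (a - d) * (b - d) := by
  have h : ∀ t : I, upperCopula a b d t t + upperCopula a b d t (σ t) =
      (fun s : ℝ ↦ min s (d + max (s - a) 0 + max (s - b) 0) +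
        min (min s (1 - s)) (d + max (s - a) 0 + max (1 - s - b) 0)) t := by
    intro t
    simp [upperCopula]
  have hab' : (a : ℝ) ≤ b := hab
  simp only [giniGamma, h]
  rw [integral_unitInterval_eq (fun s : ℝ ↦ min s (d + max (s - a) 0 + max (s - b) 0) +
      min (min s (1 - s)) (d + max (s - a) 0 + max (1 - s - b) 0)),
    intervalIntegral.integral_add (Continuous.intervalIntegrable (by fun_prop) _ _)
      (Continuous.intervalIntegrable (by fun_prop) _ _),
    integral_upper_diag h₀ (by linarith) hab' (by linarith),
    integral_upper_antidiag h₀ hab' hs hd]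
  ring

/-! ### The pointwise infimum -/

theorem giniLower_bddBelow (γ : ℝ) (a b : I) :
    BddBelow {x : ℝ | ∃ C : I → I → ℝ, IsCopula C ∧ giniGamma C = γ ∧ C a b = x} :=
  ⟨0, by rintro x ⟨C, hC, -, rfl⟩; exact hC.isQuasiCopula.nonneg a b⟩

/-- Mix `C` with `W`, which lies below it and has gamma `-1`. The constraint "gamma equal to `γ`"
may thus be relaxed to "gamma at least `γ`" in the infimum. -/
theorem exists_isCopula_le {C : I → I → ℝ} {γ : ℝ} (hC : IsCopula C) (h₁ : -1 ≤ γ)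
    (h₂ : γ ≤ giniGamma C) : ∃ D : I → I → ℝ, IsCopula D ∧ giniGamma D = γ ∧
      ∀ a b, D a b ≤ C a b := by
  rcases h₁.eq_or_lt with rfl | h₁
  · exact ⟨frechetW, isCopula_frechetW, giniGamma_frechetW, hC.isQuasiCopula.frechetW_le⟩
  have hpos : 0 < giniGamma C + 1 := by linarith
  -- The weight solves `l * giniGamma C - (1 - l) = γ`.
  set l := (γ + 1) / (giniGamma C + 1) with hl
  have hl₀ : 0 ≤ l := div_nonneg (by linarith) hpos.le
  have hl₁ : l ≤ 1 := (div_le_one hpos).2 (by linarith)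
  refine ⟨_, hC.convexComb isCopula_frechetW hl₀ hl₁, ?_, fun a b ↦ ?_⟩
  · rw [giniGamma_convexComb hC isCopula_frechetW, giniGamma_frechetW]
    have : l * (giniGamma C + 1) = γ + 1 := div_mul_cancel₀ _ hpos.ne'
    linarith
  · nlinarith [hC.isQuasiCopula.frechetW_le a b]

theorem giniLower_le {C : I → I → ℝ} {γ : ℝ} (hC : IsCopula C) (h₁ : -1 ≤ γ)
    (h₂ : γ ≤ giniGamma C) (a b : I) : giniLower γ a b ≤ C a b := by
  obtain ⟨D, hD, hDγ, hDC⟩ := exists_isCopula_le hC h₁ h₂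
  exact (csInf_le (giniLower_bddBelow γ a b) ⟨D, hD, hDγ, rfl⟩).trans (hDC a b)

theorem le_giniLower {γ x : ℝ} (h₁ : -1 ≤ γ) (h₂ : γ ≤ 1) {a b : I}
    (h : ∀ C : I → I → ℝ, IsCopula C → giniGamma C = γ → x ≤ C a b) : x ≤ giniLower γ a b := by
  obtain ⟨D, hD, hDγ, -⟩ := exists_isCopula_le isCopula_frechetM h₁
    (h₂.trans_eq giniGamma_frechetM.symm)
  refine le_csInf ⟨D a b, D, hD, hDγ, rfl⟩ ?_
  rintro y ⟨C, hC, hCγ, rfl⟩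
  exact h C hC hCγ

variable {γ : ℝ}

theorem frechetW_le_giniLower (h₁ : -1 ≤ γ) (h₂ : γ ≤ 1) (a b : I) :
    frechetW a b ≤ giniLower γ a b :=
  le_giniLower h₁ h₂ fun _ hC _ ↦ hC.isQuasiCopula.frechetW_le a b

theorem giniLower_le_frechetM (h₁ : -1 ≤ γ) (h₂ : γ ≤ 1) (a b : I) :
    giniLower γ a b ≤ frechetM a b :=
  giniLower_le isCopula_frechetM h₁ (h₂.trans_eq giniGamma_frechetM.symm) a b

theorem giniLower_mono {γ' : ℝ} (h₁ : -1 ≤ γ) (h : γ ≤ γ') (h₂ : γ' ≤ 1) (a b : I) :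
    giniLower γ a b ≤ giniLower γ' a b :=
  le_giniLower (h₁.trans h) h₂ fun _ hC hCγ ↦ giniLower_le hC h₁ (h.trans_eq hCγ.symm) a b

theorem giniLower_swap (h₁ : -1 ≤ γ) (h₂ : γ ≤ 1) (a b : I) :
    giniLower γ a b = giniLower γ b a := by
  have key : ∀ a b : I, giniLower γ a b ≤ giniLower γ b a := fun a b ↦
    le_giniLower h₁ h₂ fun C hC hCγ ↦
      giniLower_le hC.swap h₁ (by rw [hC.giniGamma_swap, hCγ]) a b
  exact (key a b).antisymm (key b a)

/-- Survival is a gamma-preserving involution on copulas, so one inequality applied at the reflected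
point yields the other. -/
theorem giniLower_eq_add_symm (h₁ : -1 ≤ γ) (h₂ : γ ≤ 1) (a b : I) :
    giniLower γ a b = a + b - 1 + giniLower γ (σ a) (σ b) := by
  have key : ∀ a b : I, giniLower γ a b ≤ a + b - 1 + giniLower γ (σ a) (σ b) := fun a b ↦ by
    have : giniLower γ a b - (a + b - 1) ≤ giniLower γ (σ a) (σ b) :=
      le_giniLower h₁ h₂ fun C hC hCγ ↦ by
        have := giniLower_le hC.survival h₁ (by rw [hC.giniGamma_survival, hCγ]) a b
        rw [survival_apply] at this
        linarith
    linarith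
  have h := key (σ a) (σ b)
  simp only [symm_symm, coe_symm_eq] at h
  exact (key a b).antisymm (by linarith)

theorem survival_giniLower (h₁ : -1 ≤ γ) (h₂ : γ ≤ 1) :
    survival (giniLower γ) = giniLower γ := by
  funext a b
  rw [survival_apply, ← giniLower_eq_add_symm h₁ h₂]

theorem isQuasiCopula_giniLower (h₁ : -1 ≤ γ) (h₂ : γ ≤ 1) : IsQuasiCopula (giniLower γ) := by
  have hW := isCopula_frechetW
  have hM := isCopula_frechetM
  have hlow := frechetW_le_giniLower h₁ h₂
  have hupp := giniLower_le_frechetM h₁ h₂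
  have hlip : ∀ a a' b b' : I,
      giniLower γ a b - giniLower γ a' b' ≤ |(a : ℝ) - a'| + |(b : ℝ) - b'| := by
    intro a a' b b'
    have : giniLower γ a b - (|(a : ℝ) - a'| + |(b : ℝ) - b'|) ≤ giniLower γ a' b' :=
      le_giniLower h₁ h₂ fun C hC hCγ ↦ by
        have h₃ := giniLower_le hC h₁ hCγ.ge a b
        have h₄ := (le_abs_self _).trans (hC.isQuasiCopula.lipschitz a a' b b')
        linarith
    linarith
  refine ⟨fun b ↦ ?_, fun a ↦ ?_, fun b ↦ ?_, fun a ↦ ?_, fun a a' b b' ha hb ↦ ?_,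
    fun a a' b b' ↦ abs_le.2 ⟨?_, hlip a a' b b'⟩⟩
  · exact le_antisymm ((hupp 0 b).trans_eq (hM.zero_left b)) ((hW.zero_left b).ge.trans (hlow 0 b))
  · exact le_antisymm ((hupp a 0).trans_eq (hM.zero_right a))
      ((hW.zero_right a).ge.trans (hlow a 0))
  · exact le_antisymm ((hupp 1 b).trans_eq (hM.one_left b)) ((hW.one_left b).ge.trans (hlow 1 b))
  · exact le_antisymm ((hupp a 1).trans_eq (hM.one_right a)) ((hW.one_right a).ge.trans (hlow a 1))
  · exact le_giniLower h₁ h₂ fun C hC hCγ ↦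
      (giniLower_le hC h₁ hCγ.ge a b).trans (hC.isQuasiCopula.mono a a' b b' ha hb)
  · have := hlip a' a b' b
    rw [abs_sub_comm (a : ℝ), abs_sub_comm (b : ℝ)]
    linarith

theorem concordanceLE_giniLower {γ' : ℝ} (h₁ : -1 ≤ γ) (h : γ ≤ γ') (h₂ : γ' ≤ 1) :
    ConcordanceLE (giniLower γ) (giniLower γ') := by
  rw [ConcordanceLE, survival_giniLower h₁ (h.trans h₂), survival_giniLower (h₁.trans h) h₂]
  exact ⟨giniLower_mono h₁ h h₂, giniLower_mono h₁ h h₂⟩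

theorem giniLower_le_of_upper (h₁ : -1 ≤ γ) {a b : I} {d : ℝ} (h₀ : 0 ≤ d) (hab : a ≤ b)
    (hs : (a : ℝ) + b ≤ 1) (hd : d ≤ 2 * a + b - 1)
    (h : γ ≤ 1 + ((a : ℝ) + b - 1) ^ 2 - 6 * (a - d) * (b - d)) : giniLower γ a b ≤ d := by
  have hab' : (a : ℝ) ≤ b := hab
  have hda : d ≤ a := by linarith
  have hdb : d ≤ b := by linarith
  have := giniLower_le (isCopula_upperCopula h₀ (by linarith) hda hdb) h₁
    (h.trans_eq (giniGamma_upperCopula h₀ hab hs hd).symm) a b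
  rwa [upperCopula_self hda hdb] at this

/-- `C` lies below the upper copula through its own value at `(a, b)`. Together with
`giniLower_le_of_upper` this bounds the infimum from both sides by the same quadratic. -/
theorem IsCopula.giniGamma_le {C : I → I → ℝ} (hC : IsCopula C) {a b : I} (hab : a ≤ b)
    (hs : (a : ℝ) + b ≤ 1) (hd : C a b ≤ 2 * a + b - 1) :
    giniGamma C ≤ 1 + ((a : ℝ) + b - 1) ^ 2 - 6 * (a - C a b) * (b - C a b) := by
  have hab' : (a : ℝ) ≤ b := hab
  have h₀ := hC.isQuasiCopula.nonneg a b
  rw [← giniGamma_upperCopula h₀ hab hs hd]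
  exact hC.isQuasiCopula.giniGamma_mono
    (isCopula_upperCopula h₀ (by linarith) (by linarith) (by linarith)).isQuasiCopula
    (hC.isQuasiCopula.le_upperCopula a b)

/-! ### Extreme values of `γ` and the strict inequality (vi). -/

theorem giniLower_symm_eq_zero (h₁ : -1 ≤ γ) (h₂ : γ ≤ -1 / 2) (a : I) :
    giniLower γ a (σ a) = 0 := by
  have key : ∀ a : I, a ≤ σ a → giniLower γ a (σ a) ≤ 0 := by
    intro a ha
    have := a.2.1
    refine giniLower_le_of_upper h₁ le_rfl ha (by simp)
      (by rw [coe_symm_eq]; linarith) ?_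
    rw [coe_symm_eq]
    -- With `d = 0` on the antidiagonal gamma is `1 - 6a(1-a)`, which is at least `-1/2`.
    nlinarith [sq_nonneg ((a : ℝ) - 1 / 2)]
  refine le_antisymm ?_ ((isQuasiCopula_giniLower h₁ (by linarith)).nonneg _ _)
  rcases le_total a (σ a) with h | h
  · exact key a h
  · rw [giniLower_swap h₁ (by linarith)]
    have := key (σ a)
    rw [symm_symm] at this
    exact this h

theorem giniLower_eq_frechetW (h₁ : -1 ≤ γ) (h₂ : γ ≤ -1 / 2) : giniLower γ = frechetW := by
  have key : ∀ a b : I, (a : ℝ) + b ≤ 1 → giniLower γ a b ≤ 0 := by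
    intro a b hs
    rw [← giniLower_symm_eq_zero h₁ h₂ a]
    refine (isQuasiCopula_giniLower h₁ (by linarith)).mono _ _ _ _ le_rfl ?_
    change (b : ℝ) ≤ 1 - a
    linarith
  funext a b
  refine le_antisymm ?_ (frechetW_le_giniLower h₁ (by linarith) a b)
  rcases le_total ((a : ℝ) + b) 1 with hs | hs
  · exact le_max_of_le_left (key a b hs)
  · rw [giniLower_eq_add_symm h₁ (by linarith)]
    have := key (σ a) (σ b) (by simp only [coe_symm_eq]; linarith)
    exact le_max_of_le_right (by linarith)

/-- Gamma equal to 1 forces `C t t = t` on the whole diagonal, and monotonicity then forces `C = M`.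
-/
theorem IsCopula.eq_frechetM {C : I → I → ℝ} (hC : IsCopula C) (h : giniGamma C = 1) :
    C = frechetM := by
  have hdiag : ∀ t : I, C t t = t := by
    intro t
    by_contra hne
    have hlt : C t t < frechetM t t :=
      lt_of_le_of_ne (hC.isQuasiCopula.le_frechetM t t) (by simpa [frechetM] using hne)
    have := hC.isQuasiCopula.giniGamma_lt isCopula_frechetM.isQuasiCopula
      hC.isQuasiCopula.le_frechetM t hlt
    rw [h, giniGamma_frechetM] at this
    exact lt_irrefl _ this
  funext a b
  refine le_antisymm (hC.isQuasiCopula.le_frechetM a b) ?_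
  rcases le_total a b with hab | hab
  · exact (min_le_left _ _).trans ((hdiag a).ge.trans (hC.mono_right a hab))
  · exact (min_le_right _ _).trans ((hdiag b).ge.trans (hC.mono_left b hab))

theorem giniLower_one : giniLower 1 = frechetM := by
  funext a b
  refine le_antisymm (giniLower_le_frechetM (by norm_num) le_rfl a b) ?_
  exact le_giniLower (by norm_num) le_rfl fun C hC hCγ ↦ by rw [hC.eq_frechetM hCγ]

theorem giniGamma_giniLower_lt (h₁ : -1 < γ) (h₂ : γ < 1) : giniGamma (giniLower γ) < γ := by
  set C : I → I → ℝ := fun a b ↦ (1 + γ) / 2 * frechetM a b + (1 - (1 + γ) / 2) * frechetW a b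
  have hC : IsCopula C :=
    isCopula_frechetM.convexComb isCopula_frechetW (by linarith) (by linarith)
  have hCγ : giniGamma C = γ := by
    rw [giniGamma_convexComb isCopula_frechetM isCopula_frechetW, giniGamma_frechetM,
      giniGamma_frechetW]
    ring
  let m : I := ⟨1 / 2, by norm_num, by norm_num⟩
  have hm : (m : ℝ) = 1 / 2 := rfl
  -- `(2γ+1)/6` interpolates linearly between 0 at `γ = -1/2` and `1/2` at `γ = 1`. It avoids the
  -- square root of the sharp bound and still lies below the mixture's value `(1+γ)/4`.
  have hd : giniLower γ m m ≤ max 0 ((2 * γ + 1) / 6) := by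
    refine giniLower_le_of_upper h₁.le (le_max_left _ _) le_rfl (by rw [hm]; norm_num)
      (max_le (by rw [hm]; norm_num) (by rw [hm]; linarith)) ?_
    rw [hm]
    rcases max_cases 0 ((2 * γ + 1) / 6) with ⟨h, h'⟩ | ⟨h, h'⟩ <;> rw [h] <;> nlinarith
  have hCm : C m m = (1 + γ) / 4 := by
    simp only [C, frechetM, frechetW, hm]
    norm_num
    ring
  have hlt : giniLower γ m m < C m m := by
    rw [hCm]
    exact hd.trans_lt (max_lt (by linarith) (by linarith))
  have := (isQuasiCopula_giniLower h₁.le h₂.le).giniGamma_lt hC.isQuasiCopula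
    (giniLower_le hC h₁.le hCγ.ge) m hlt
  rwa [hCγ] at this

end Infimum

section Sheet

/-! ### The explicit form of the infimum -/

/-- The square root occurring in the explicit form of `giniLower`. -/
noncomputable def sheetRoot (γ x y : ℝ) : ℝ := √((x - y) ^ 2 + 2 / 3 * ((x + y - 1) ^ 2 + (1 - γ)))

/-- The smooth function with which `giniLower γ` agrees between the two hyperbolas. -/
noncomputable def sheet (γ x y : ℝ) : ℝ := (x + y - sheetRoot γ x y) / 2

theorem sheetRoot_sq {γ : ℝ} (hγ : γ ≤ 1) (x y : ℝ) :
    sheetRoot γ x y ^ 2 = (x - y) ^ 2 + 2 / 3 * ((x + y - 1) ^ 2 + (1 - γ)) := by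
  refine Real.sq_sqrt ?_
  have : 0 ≤ 1 - γ := by linarith
  positivity

theorem sheetRoot_nonneg (γ x y : ℝ) : 0 ≤ sheetRoot γ x y := Real.sqrt_nonneg _

theorem sheet_comm (γ x y : ℝ) : sheet γ x y = sheet γ y x := by
  rw [sheet, sheet, sheetRoot, sheetRoot]
  ring_nf

theorem sheet_symm (γ x y : ℝ) : sheet γ (1 - x) (1 - y) = sheet γ x y + 1 - x - y := by
  have : sheetRoot γ (1 - x) (1 - y) = sheetRoot γ x y := by
    rw [sheetRoot, sheetRoot]
    ring_nf
  rw [sheet, sheet, this]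
  ring

theorem sheet_le_left {γ : ℝ} (hγ : γ ≤ 1) (x y : ℝ) : sheet γ x y ≤ x := by
  have : |x - y| ≤ sheetRoot γ x y := by
    refine abs_le_of_sq_le_sq ?_ (sheetRoot_nonneg γ x y)
    rw [sheetRoot_sq hγ]
    nlinarith [sq_nonneg (x + y - 1)]
  have := neg_abs_le (x - y)
  rw [sheet]
  linarith

/-- By `4(x-d)(y-d) = (x+y-2d)² - (x-y)²`, the right side compares `x + y - 2d` with `sheetRoot`.
Hence `sheet` is the least `d` at which the gamma formula reaches `γ`. -/
theorem sheet_le_iff {γ x y d : ℝ} (hγ : γ ≤ 1) (hx : d ≤ x) (hy : d ≤ y) :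
    sheet γ x y ≤ d ↔ 6 * (x - d) * (y - d) ≤ (x + y - 1) ^ 2 + (1 - γ) := by
  have h₁ := sheetRoot_sq hγ x y
  have h₂ := sheetRoot_nonneg γ x y
  rw [sheet]
  constructor
  · intro h
    nlinarith
  · intro h
    have : x + y - 2 * d ≤ sheetRoot γ x y := by
      refine abs_le_of_sq_le_sq' ?_ h₂ |>.2
      rw [h₁]
      linarith
    linarith

theorem IsCopula.sheet_le {C : I → I → ℝ} (hC : IsCopula C) {a b : I} (hab : a ≤ b)
    (hs : (a : ℝ) + b ≤ 1) (hd : C a b ≤ 2 * a + b - 1) :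
    sheet (giniGamma C) a b ≤ C a b := by
  have hγ : giniGamma C ≤ 1 := by
    rw [← giniGamma_frechetM]
    exact hC.isQuasiCopula.giniGamma_mono isCopula_frechetM.isQuasiCopula
      hC.isQuasiCopula.le_frechetM
  rw [sheet_le_iff hγ ((hC.isQuasiCopula.le_frechetM a b).trans (min_le_left _ _))
    ((hC.isQuasiCopula.le_frechetM a b).trans (min_le_right _ _))]
  have := hC.giniGamma_le hab hs hd
  linarith

variable {γ : ℝ}

theorem giniLower_le_max_sheet (h₁ : -1 ≤ γ) (h₂ : γ ≤ 1) {a b : I} (hab : a ≤ b)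
    (hs : (a : ℝ) + b ≤ 1) (hW : 0 ≤ 2 * (a : ℝ) + b - 1)
    (hd : sheet γ a b ≤ 2 * a + b - 1) : giniLower γ a b ≤ max 0 (sheet γ a b) := by
  have hab' : (a : ℝ) ≤ b := hab
  have h₃ : max 0 (sheet γ a b) ≤ 2 * a + b - 1 := max_le hW hd
  refine giniLower_le_of_upper h₁ (le_max_left _ _) hab hs h₃ ?_
  have := (sheet_le_iff h₂ (d := max 0 (sheet γ a b)) (x := a) (y := b)
    (by linarith) (by linarith)).1 (le_max_right _ _)
  linarith

/-- For `γ ≤ 0`, wherever `sheet` is positive it stays in the range of `d` where the gamma formula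
is valid. -/
theorem sheet_le_max (h : γ ≤ 0) {x y : ℝ} (hx : 0 ≤ x) (hxy : x ≤ y) (hs : x + y ≤ 1) :
    sheet γ x y ≤ max 0 (2 * x + y - 1) := by
  rw [sheet_le_iff (by linarith) (max_le hx (by linarith)) (max_le (by linarith) (by linarith))]
  rcases max_cases 0 (2 * x + y - 1) with ⟨h', h''⟩ | ⟨h', h''⟩ <;> rw [h']
  · nlinarith [sq_nonneg (x - 1 / 4), sq_nonneg (x + y - 1), mul_nonneg hx (sub_nonneg.2 h'')]
  · have h₃ : 0 ≤ 1 - 2 * x := by linarith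
    have h₄ : 0 ≤ x - (1 - x - y) := by linarith
    nlinarith [sq_nonneg (x - 1 / 4), sq_nonneg (x + y - 1), mul_nonneg h₃ h₄]

theorem giniLower_eq_of_le (h₁ : -1 ≤ γ) (h₂ : γ ≤ 0) {a b : I} (hab : a ≤ b)
    (hs : (a : ℝ) + b ≤ 1) : giniLower γ a b = max 0 (sheet γ a b) := by
  have hab' : (a : ℝ) ≤ b := hab
  have ha := a.2.1
  have hmax := sheet_le_max h₂ ha hab' hs
  have hQ := isQuasiCopula_giniLower h₁ (h₂.trans zero_le_one)
  refine le_antisymm ?_ (max_le (hQ.nonneg a b) ?_)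
  · rcases le_total 0 (2 * (a : ℝ) + b - 1) with hW | hW
    · rw [max_eq_right hW] at hmax
      exact giniLower_le_max_sheet h₁ (by linarith) hab hs hW hmax
    · refine le_max_of_le_left ?_
      -- Below `b = 1 - 2a` the formula is unavailable even at `d = 0`, so the value 0 is
      -- established at `1 - 2a` and transferred by monotonicity.
      let b' : I := ⟨1 - 2 * a, by linarith, by linarith⟩
      have hb' : (b' : ℝ) = 1 - 2 * a := rfl
      have hbb' : b ≤ b' := by
        change (b : ℝ) ≤ 1 - 2 * a
        linarith
      refine (hQ.mono a a b b' le_rfl hbb').trans (giniLower_le_of_upper h₁ le_rfl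
        (hab.trans hbb') (by rw [hb']; linarith) (by rw [hb']; linarith) ?_)
      rw [hb']
      -- Gamma is `1 - 6a + 13a²` here, with minimum `4/13` at `a = 3/13`.
      nlinarith [sq_nonneg ((a : ℝ) - 3 / 13)]
  · refine le_giniLower h₁ (by linarith) fun C hC hCγ ↦ ?_
    by_contra hlt
    push Not at hlt
    have h₀ := hC.isQuasiCopula.nonneg a b
    have hW : C a b ≤ 2 * a + b - 1 := by
      rcases max_cases 0 (2 * (a : ℝ) + b - 1) with ⟨h', h''⟩ | ⟨h', h''⟩ <;>
        rw [h'] at hmax <;> linarith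
    have := hC.sheet_le hab hs hW
    rw [hCγ] at this
    linarith

/-- The explicit form of `giniLower γ` for `γ ≤ 0`. -/
theorem giniLower_eq (h₁ : -1 ≤ γ) (h₂ : γ ≤ 0) (a b : I) :
    giniLower γ a b = max (frechetW a b) (sheet γ a b) := by
  have hγ : γ ≤ 1 := h₂.trans zero_le_one
  have key : ∀ a b : I, (a : ℝ) + b ≤ 1 → giniLower γ a b = max 0 (sheet γ a b) := by
    intro a b hs
    rcases le_total a b with hab | hab
    · exact giniLower_eq_of_le h₁ h₂ hab hs
    · rw [giniLower_swap h₁ hγ, sheet_comm]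
      exact giniLower_eq_of_le h₁ h₂ hab (by linarith)
  rcases le_total ((a : ℝ) + b) 1 with hs | hs
  · rw [key a b hs, frechetW, max_eq_left (a := (0 : ℝ)) (b := (a : ℝ) + b - 1) (by linarith)]
  · rw [giniLower_eq_add_symm h₁ hγ, key (σ a) (σ b) (by simp only [coe_symm_eq]; linarith),
      frechetW, max_eq_right (a := (0 : ℝ)) (b := (a : ℝ) + b - 1) (by linarith), coe_symm_eq, coe_symm_eq, sheet_symm,
      ← max_add_add_left]
    congr 1 <;> ring

/-! ### Failure of 2-increasingness for positive `γ`. -/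

theorem sheet_le_giniLower_symm (h₁ : -1 ≤ γ) (h₂ : γ ≤ 1) {a b : I} (hab : a ≤ b)
    (hs : (a : ℝ) + b = 1) : sheet γ a b ≤ giniLower γ a b :=
  le_giniLower h₁ h₂ fun C hC hCγ ↦ by
    -- On the antidiagonal `2a + b - 1 = a`, so the range condition is automatic for every `γ`.
    have := hC.sheet_le hab hs.le (by
      have := (hC.isQuasiCopula.le_frechetM a b).trans (min_le_left _ _)
      linarith)
    rwa [hCγ] at this

/-- `h` is half the side of a square centred at `((1-p)/2, (1+p)/2)`. The bounds keep it above the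
diagonal, make `sheet` positive and within the valid range at its lower left corner, and make its
volume negative. -/
theorem exists_small_square {p k : ℝ} (hp : 0 < p) (h₁ : p ^ 2 + k < 1) (h₂ : k < 2 * p ^ 2)
    (hk : 0 < k) : ∃ h : ℝ, 0 < h ∧ 2 * h < p ∧ √(p ^ 2 + k + 8 / 3 * h ^ 2) + 2 * h < 1 ∧
      p + 4 * h < √(p ^ 2 + k + 8 / 3 * h ^ 2) ∧ 16 / 9 * h ^ 2 < 2 / 3 * (2 * p ^ 2 - k) := by
  have hc : ∀ f : ℝ → ℝ, Continuous f → 0 < f 0 → ∀ᶠ h in nhdsWithin (0 : ℝ) (Set.Ioi 0), 0 < f h :=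
    fun f hf h0 ↦ (hf.tendsto 0).eventually (lt_mem_nhds h0) |>.filter_mono nhdsWithin_le_nhds
  have e₁ := hc (fun h ↦ p - 2 * h) (by fun_prop) (by simpa using hp)
  have e₂ := hc (fun h ↦ 1 - √(p ^ 2 + k + 8 / 3 * h ^ 2) - 2 * h) (by fun_prop) (by
    have : √(p ^ 2 + k) < 1 := by
      rw [Real.sqrt_lt' one_pos]
      linarith
    simpa using this)
  have e₃ := hc (fun h ↦ √(p ^ 2 + k + 8 / 3 * h ^ 2) - p - 4 * h) (by fun_prop) (by
    have : p < √(p ^ 2 + k) := Real.lt_sqrt_of_sq_lt (by linarith)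
    simpa using this)
  have e₄ := hc (fun h ↦ 2 / 3 * (2 * p ^ 2 - k) - 16 / 9 * h ^ 2) (by fun_prop) (by
    linarith)
  obtain ⟨h, h₃, h₄, h₅, h₆, h₇⟩ :=
    (e₁.and (e₂.and (e₃.and (e₄.and self_mem_nhdsWithin)))).exists
  exact ⟨h, h₇, by linarith, by linarith, by linarith, by linarith⟩

theorem sqrt_add_sqrt_lt {p k h : ℝ} (hk : 0 < k) (hh : 0 < h)
    (hlt : 16 / 9 * h ^ 2 < 2 / 3 * (2 * p ^ 2 - k)) :
    √((p + 2 * h) ^ 2 + k) + √((p - 2 * h) ^ 2 + k) < 2 * √(p ^ 2 + k + 8 / 3 * h ^ 2) := by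
  set X := √((p + 2 * h) ^ 2 + k)
  set Y := √((p - 2 * h) ^ 2 + k)
  set Z := √(p ^ 2 + k + 8 / 3 * h ^ 2)
  have hX : X ^ 2 = (p + 2 * h) ^ 2 + k := Real.sq_sqrt (by positivity)
  have hY : Y ^ 2 = (p - 2 * h) ^ 2 + k := Real.sq_sqrt (by positivity)
  have hZ : Z ^ 2 = p ^ 2 + k + 8 / 3 * h ^ 2 := Real.sq_sqrt (by positivity)
  have hZ₀ : 0 ≤ Z := Real.sqrt_nonneg _
  have hXY : X * Y < p ^ 2 + k + 4 / 3 * h ^ 2 := by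
    refine lt_of_pow_lt_pow_left₀ 2 (by positivity) ?_
    rw [mul_pow, hX, hY]
    have : 0 < h ^ 2 * (2 / 3 * (2 * p ^ 2 - k) - 16 / 9 * h ^ 2) :=
      mul_pos (by positivity) (by linarith)
    nlinarith
  refine lt_of_pow_lt_pow_left₀ 2 (by positivity) ?_
  nlinarith

theorem not_isCopula_giniLower (h₁ : 0 < γ) (h₂ : γ < 1) : ¬ IsCopula (giniLower γ) := by
  intro hcop
  set k : ℝ := 2 / 3 * (1 - γ) with hk
  -- The density of `sheet` on the antidiagonal is negative for `p² > k/2`, while `sheet > 0` needs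
  -- `p² < 1 - k`. This window is nonempty exactly when `γ > 0`; `p²` is its midpoint.
  set p : ℝ := √((2 - k) / 4) with hp
  have hk₀ : 0 < k := by rw [hk]; linarith
  have hk₁ : k < 2 / 3 := by rw [hk]; linarith
  have hp₀ : 0 < p := Real.sqrt_pos.2 (by linarith)
  have hp₂ : p ^ 2 = (2 - k) / 4 := Real.sq_sqrt (by linarith)
  obtain ⟨h, hh, hhp, hz₁, hz₂, hlt⟩ := exists_small_square (p := p) (k := k) hp₀
    (by linarith) (by linarith) hk₀
  have hneg := sqrt_add_sqrt_lt hk₀ hh hlt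
  set Z := √(p ^ 2 + k + 8 / 3 * h ^ 2) with hZ
  let a₁ : I := ⟨(1 - p) / 2 - h, by linarith, by linarith⟩
  let a₂ : I := ⟨(1 - p) / 2 + h, by linarith, by linarith⟩
  let b₁ : I := ⟨(1 + p) / 2 - h, by linarith, by linarith⟩
  let b₂ : I := ⟨(1 + p) / 2 + h, by linarith, by linarith⟩
  have ea₁ : (a₁ : ℝ) = (1 - p) / 2 - h := rfl
  have ea₂ : (a₂ : ℝ) = (1 - p) / 2 + h := rfl
  have eb₁ : (b₁ : ℝ) = (1 + p) / 2 - h := rfl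
  have eb₂ : (b₂ : ℝ) = (1 + p) / 2 + h := rfl
  have hvol := hcop.two_increasing a₁ a₂ b₁ b₂
    (show (1 - p) / 2 - h ≤ (1 - p) / 2 + h by linarith)
    (show (1 + p) / 2 - h ≤ (1 + p) / 2 + h by linarith)
  have hγ : -1 ≤ γ := by linarith
  have l₁ := sheet_le_giniLower_symm hγ h₂.le (a := a₁) (b := b₂)
    (show (1 - p) / 2 - h ≤ (1 + p) / 2 + h by linarith) (by rw [ea₁, eb₂]; ring)
  have l₂ := sheet_le_giniLower_symm hγ h₂.le (a := a₂) (b := b₁)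
    (show (1 - p) / 2 + h ≤ (1 + p) / 2 - h by linarith) (by rw [ea₂, eb₁]; ring)
  have s₁ : sheet γ a₁ b₂ = (1 - √((p + 2 * h) ^ 2 + k)) / 2 := by
    rw [sheet, sheetRoot, ea₁, eb₂, hk]
    ring_nf
  have s₂ : sheet γ a₂ b₁ = (1 - √((p - 2 * h) ^ 2 + k)) / 2 := by
    rw [sheet, sheetRoot, ea₂, eb₁, hk]
    ring_nf
  have s₃ : sheet γ a₁ b₁ = (1 - 2 * h - Z) / 2 := by
    rw [sheet, sheetRoot, ea₁, eb₁, hZ, hk]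
    ring_nf
  have u₁ := giniLower_le_max_sheet hγ h₂.le (a := a₁) (b := b₁)
    (show (1 - p) / 2 - h ≤ (1 + p) / 2 - h by linarith) (by rw [ea₁, eb₁]; linarith)
    (by rw [ea₁, eb₁]; linarith) (by rw [s₃, ea₁, eb₁]; linarith)
  -- The upper right corner is the survival image of the transposed lower left one, so a single
  -- upper bound serves both.
  have e₂₂ : giniLower γ a₂ b₂ = 2 * h + giniLower γ a₁ b₁ := by
    have ha : σ a₂ = b₁ := Subtype.ext (by rw [coe_symm_eq, ea₂, eb₁]; ring)
    have hb : σ b₂ = a₁ := Subtype.ext (by rw [coe_symm_eq, eb₂, ea₁]; ring)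
    rw [giniLower_eq_add_symm hγ h₂.le, ha, hb, giniLower_swap hγ h₂.le b₁, ea₂, eb₂]
    ring
  rw [s₃, max_eq_right (by linarith)] at u₁
  rw [s₁] at l₁
  rw [s₂] at l₂
  linarith

end Sheet

section Arcs

/-! ### The edges of the hyperbolic region -/

/-- The quadratic polynomial whose sign decides whether `sheet` is positive. -/
def arcPoly (γ x y : ℝ) : ℝ := 6 * x * y - (x + y - 1) ^ 2 - (1 - γ)

/-- The lower edge of the hyperbolic region, continued along the antidiagonal. -/
noncomputable def lowerArc (γ x : ℝ) : ℝ := min (1 + 2 * x - √(3 * (x + 1) ^ 2 - 4 + γ)) (1 - x)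

/-- The upper edge of the hyperbolic region, continued along the antidiagonal. -/
noncomputable def upperArc (γ x : ℝ) : ℝ := 1 - lowerArc γ (1 - x)

/-- The partial derivative of `sheet` in the first variable. -/
noncomputable def sheetSlope (γ x y : ℝ) : ℝ :=
  (1 - (x - y + 2 / 3 * (x + y - 1)) / sheetRoot γ x y) / 2

/-- The mixed second derivative of `sheet`. -/
noncomputable def sheetDensity (γ x y : ℝ) : ℝ :=
  ((x + y - 1) ^ 2 - (x - y) ^ 2 + (1 - γ) / 3) / (3 * sheetRoot γ x y ^ 3)

variable {γ x y : ℝ}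

theorem continuous_lowerArc (γ : ℝ) : Continuous (lowerArc γ) := by
  unfold lowerArc
  fun_prop

theorem continuous_upperArc (γ : ℝ) : Continuous (upperArc γ) := by
  have := continuous_lowerArc γ
  unfold upperArc
  fun_prop

theorem continuous_sheetRoot (γ : ℝ) : Continuous fun p : ℝ × ℝ ↦ sheetRoot γ p.1 p.2 := by
  unfold sheetRoot
  fun_prop

theorem continuous_sheet (γ : ℝ) : Continuous fun p : ℝ × ℝ ↦ sheet γ p.1 p.2 := by
  have := continuous_sheetRoot γ
  unfold sheet
  fun_prop

theorem sheetRoot_pos (hγ : γ < 1) (x y : ℝ) : 0 < sheetRoot γ x y := by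
  have : 0 < 1 - γ := by linarith
  exact Real.sqrt_pos.2 (by positivity)

theorem continuous_sheetSlope (hγ : γ < 1) :
    Continuous fun p : ℝ × ℝ ↦ sheetSlope γ p.1 p.2 := by
  have := continuous_sheetRoot γ
  have h₀ : ∀ p : ℝ × ℝ, sheetRoot γ p.1 p.2 ≠ 0 := fun p ↦ (sheetRoot_pos hγ p.1 p.2).ne'
  unfold sheetSlope
  fun_prop (disch := assumption)

theorem continuous_sheetDensity (hγ : γ < 1) :
    Continuous fun p : ℝ × ℝ ↦ sheetDensity γ p.1 p.2 := by
  have := continuous_sheetRoot γ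
  have h₀ : ∀ p : ℝ × ℝ, 3 * sheetRoot γ p.1 p.2 ^ 3 ≠ 0 := fun p ↦ by
    have := sheetRoot_pos hγ p.1 p.2
    positivity
  unfold sheetDensity
  fun_prop (disch := assumption)

/-- As a quadratic in `y`, `arcPoly` equals `3(x+1)² - 4 + γ - (1+2x-y)²`. For a negative radicand
the square root is 0 and both sides are false. -/
theorem arcPoly_pos_iff (hx : 0 ≤ x) (hy : y ≤ 1) :
    0 < arcPoly γ x y ↔ 1 + 2 * x - √(3 * (x + 1) ^ 2 - 4 + γ) < y := by
  have h : 1 + 2 * x - √(3 * (x + 1) ^ 2 - 4 + γ) < y ↔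
      1 + 2 * x - y < √(3 * (x + 1) ^ 2 - 4 + γ) := by
    constructor <;> intro h <;> linarith
  rw [h, Real.lt_sqrt (by linarith), ← sub_pos (b := (1 + 2 * x - y) ^ 2), arcPoly]
  ring_nf

theorem arcPoly_antidiag (γ x : ℝ) : arcPoly γ x (1 - x) = arcPoly γ (1 - x) (1 - (1 - x)) := by
  rw [arcPoly, arcPoly]
  ring

theorem lowerArc_le (γ x : ℝ) : lowerArc γ x ≤ 1 - x := min_le_right _ _

theorem le_upperArc (γ x : ℝ) : 1 - x ≤ upperArc γ x := by
  have := lowerArc_le γ (1 - x)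
  rw [upperArc]
  linarith

theorem lowerArc_nonneg (hγ : γ ≤ 0) (hx : 0 ≤ x) (hx' : x ≤ 1) : 0 ≤ lowerArc γ x := by
  refine le_min ?_ (by linarith)
  have : √(3 * (x + 1) ^ 2 - 4 + γ) ≤ 1 + 2 * x := by
    rw [Real.sqrt_le_left (by linarith)]
    nlinarith [sq_nonneg (1 - x)]
  linarith

theorem upperArc_le_one (hγ : γ ≤ 0) (hx : 0 ≤ x) (hx' : x ≤ 1) : upperArc γ x ≤ 1 := by
  have := lowerArc_nonneg hγ (x := 1 - x) (by linarith) (by linarith)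
  rw [upperArc]
  linarith

/-- On the antidiagonal `arcPoly` is invariant under the central reflection, so both edges leave the
antidiagonal at the same abscissae. -/
theorem lowerArc_eq_upperArc_or (γ : ℝ) (hx : 0 ≤ x) (hx' : x ≤ 1) :
    (lowerArc γ x = 1 - x ∧ upperArc γ x = 1 - x) ∨
    (lowerArc γ x = 1 + 2 * x - √(3 * (x + 1) ^ 2 - 4 + γ) ∧
      upperArc γ x = 1 - (1 + 2 * (1 - x) - √(3 * (1 - x + 1) ^ 2 - 4 + γ))) := by
  have h₁ := arcPoly_pos_iff (γ := γ) (x := x) (y := 1 - x) hx (by linarith)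
  have h₂ := arcPoly_pos_iff (γ := γ) (x := 1 - x) (y := 1 - (1 - x)) (by linarith) (by linarith)
  rw [← arcPoly_antidiag] at h₂
  rcases le_or_gt (arcPoly γ x (1 - x)) 0 with h | h
  · rw [← not_lt] at h
    left
    rw [upperArc, lowerArc, lowerArc, min_eq_right (not_lt.1 (mt h₁.2 h)),
      min_eq_right (not_lt.1 (mt h₂.2 h))]
    exact ⟨rfl, by ring⟩
  · right
    rw [upperArc, lowerArc, lowerArc, min_eq_left (h₁.1 h).le, min_eq_left (h₂.1 h).le]
    exact ⟨rfl, rfl⟩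

/-- The hyperbolic region lies between the graphs of the two edges. -/
theorem between_arcs_iff (hx : 0 ≤ x) (hx' : x ≤ 1) (hy : 0 ≤ y) (hy' : y ≤ 1) :
    lowerArc γ x < y ∧ y < upperArc γ x ↔
      0 < arcPoly γ x y ∧ 0 < arcPoly γ (1 - x) (1 - y) := by
  rw [arcPoly_pos_iff hx hy', arcPoly_pos_iff (x := 1 - x) (by linarith) (by linarith)]
  constructor
  · rintro ⟨h₁, h₂⟩
    rcases lowerArc_eq_upperArc_or γ hx hx' with ⟨h₃, h₄⟩ | ⟨h₃, h₄⟩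
    · rw [h₃] at h₁; rw [h₄] at h₂; linarith
    · rw [h₃] at h₁; rw [h₄] at h₂; exact ⟨h₁, by linarith⟩
  · rintro ⟨h₁, h₂⟩
    have h₃ : lowerArc γ x ≤ 1 + 2 * x - √(3 * (x + 1) ^ 2 - 4 + γ) := min_le_left _ _
    have h₄ : lowerArc γ (1 - x) ≤ 1 + 2 * (1 - x) - √(3 * (1 - x + 1) ^ 2 - 4 + γ) :=
      min_le_left _ _
    rw [upperArc]
    constructor <;> linarith

theorem sheet_pos_iff (hγ : γ ≤ 1) (hx : 0 ≤ x) (hy : 0 ≤ y) :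
    0 < sheet γ x y ↔ 0 < arcPoly γ x y := by
  rw [← not_le, sheet_le_iff hγ hx hy, not_le, arcPoly]
  constructor <;> intro h <;> linarith

theorem lt_sheet_iff (hγ : γ ≤ 1) (hx : x ≤ 1) (hy : y ≤ 1) :
    x + y - 1 < sheet γ x y ↔ 0 < arcPoly γ (1 - x) (1 - y) := by
  rw [← sheet_pos_iff hγ (by linarith) (by linarith), sheet_symm]
  constructor <;> intro h <;> linarith

theorem max_sheet_of_lt_lowerArc (hγ : γ ≤ 1) (hx : 0 ≤ x) (hy : 0 ≤ y) (hy' : y ≤ 1)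
    (h : y < lowerArc γ x) : max (max 0 (x + y - 1)) (sheet γ x y) = 0 := by
  obtain ⟨h₁, h₂⟩ := lt_min_iff.1 h
  rw [max_eq_left (a := (0 : ℝ)) (by linarith), max_eq_left]
  rw [← not_lt, sheet_pos_iff hγ hx hy, arcPoly_pos_iff hx hy']
  exact not_lt.2 h₁.le

theorem max_sheet_of_between (hγ : γ ≤ 1) (hx : 0 ≤ x) (hx' : x ≤ 1) (hy : 0 ≤ y) (hy' : y ≤ 1)
    (h₁ : lowerArc γ x < y) (h₂ : y < upperArc γ x) :
    max (max 0 (x + y - 1)) (sheet γ x y) = sheet γ x y := by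
  obtain ⟨h₃, h₄⟩ := (between_arcs_iff hx hx' hy hy').1 ⟨h₁, h₂⟩
  exact max_eq_right (max_le ((sheet_pos_iff hγ hx hy).2 h₃).le ((lt_sheet_iff hγ hx' hy').2 h₄).le)

theorem max_sheet_of_upperArc_lt (hγ : γ ≤ 1) (hx' : x ≤ 1) (hy : 0 ≤ y) (hy' : y ≤ 1)
    (h : upperArc γ x < y) : max (max 0 (x + y - 1)) (sheet γ x y) = x + y - 1 := by
  have h₀ : 1 - y < lowerArc γ (1 - x) := by
    rw [upperArc] at h
    linarith
  obtain ⟨h₁, h₂⟩ := lt_min_iff.1 h₀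
  rw [max_eq_right (a := (0 : ℝ)) (by linarith), max_eq_left]
  rw [← not_lt, lt_sheet_iff hγ hx' hy', arcPoly_pos_iff (sub_nonneg.2 hx') (sub_le_self 1 hy)]
  exact not_lt.2 h₁.le

theorem hasDerivAt_sheet (hγ : γ < 1) (x y : ℝ) :
    HasDerivAt (fun x ↦ sheet γ x y) (sheetSlope γ x y) x := by
  have hN := sheetRoot_pos hγ x y
  have h₁ : HasDerivAt (fun x ↦ (x - y) ^ 2 + 2 / 3 * ((x + y - 1) ^ 2 + (1 - γ)))
      (2 * (x - y + 2 / 3 * (x + y - 1))) x := by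
    have := (((hasDerivAt_id' x).sub_const y).pow 2).add
      ((((((hasDerivAt_id' x).add_const y).sub_const 1).pow 2).add_const (1 - γ)).const_mul
        (2 / 3 : ℝ))
    refine this.congr_deriv ?_
    norm_num
    ring
  have h₂ := h₁.sqrt (Real.sqrt_pos.1 hN).ne'
  refine ((((hasDerivAt_id' x).add_const y).sub h₂).div_const 2).congr_deriv ?_
  change (1 - _ / (2 * sheetRoot γ x y)) / 2 = _
  rw [sheetSlope]
  field_simp

theorem hasDerivAt_sheetSlope (hγ : γ < 1) (x y : ℝ) :
    HasDerivAt (fun y ↦ sheetSlope γ x y) (sheetDensity γ x y) y := by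
  have hN := sheetRoot_pos hγ x y
  have hsq := sheetRoot_sq hγ.le x y
  have h₁ : HasDerivAt (fun y ↦ (x - y) ^ 2 + 2 / 3 * ((x + y - 1) ^ 2 + (1 - γ)))
      (2 * (y - x + 2 / 3 * (x + y - 1))) y := by
    have := (((hasDerivAt_id' y).const_sub x).pow 2).add
      ((((((hasDerivAt_id' y).const_add x).sub_const 1).pow 2).add_const (1 - γ)).const_mul
        (2 / 3 : ℝ))
    refine this.congr_deriv ?_
    norm_num
    ring
  have h₂ : HasDerivAt (fun y ↦ sheetRoot γ x y)
      (2 * (y - x + 2 / 3 * (x + y - 1)) / (2 * sheetRoot γ x y)) y :=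
    h₁.sqrt (Real.sqrt_pos.1 hN).ne'
  have h₃ : HasDerivAt (fun y ↦ x - y + 2 / 3 * (x + y - 1)) (-1 + 2 / 3 * 1) y :=
    ((hasDerivAt_id' y).const_sub x).add
      ((((hasDerivAt_id' y).const_add x).sub_const 1).const_mul (2 / 3 : ℝ))
  refine (((h₃.div h₂ hN.ne').const_sub 1).div_const 2).congr_deriv ?_
  rw [sheetDensity]
  field_simp
  rw [hsq]
  ring

/-- The difference of the squares is `2/9 w² + 2/3 (1-γ) - 4/3 (x-y)w` with `w = x+y-1`, and `(x-y)w
≤ 1/4`. The slope therefore lies strictly in `(0, 1)`, which makes the mass on both edges positive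
everywhere. -/
theorem abs_lt_sheetRoot (hγ : γ ≤ 0) (hx : 0 ≤ x) (hx' : x ≤ 1) :
    |x - y + 2 / 3 * (x + y - 1)| < sheetRoot γ x y := by
  refine abs_lt_of_sq_lt_sq ?_ (sheetRoot_nonneg γ x y)
  rw [sheetRoot_sq (by linarith)]
  have h₁ : (x - y) * (x + y - 1) ≤ 1 / 4 := by
    nlinarith [mul_nonneg hx (sub_nonneg.2 hx'), sq_nonneg (y - 1 / 2)]
  nlinarith [sq_nonneg (x + y - 1)]

theorem sheetSlope_pos (hγ : γ ≤ 0) (hx : 0 ≤ x) (hx' : x ≤ 1) : 0 < sheetSlope γ x y := by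
  have h := abs_lt_sheetRoot (y := y) hγ hx hx'
  have hN := sheetRoot_pos (hγ.trans_lt zero_lt_one) x y
  have := (div_lt_one hN).2 ((le_abs_self _).trans_lt h)
  rw [sheetSlope]
  linarith

theorem sheetSlope_lt_one (hγ : γ ≤ 0) (hx : 0 ≤ x) (hx' : x ≤ 1) :
    sheetSlope γ x y < 1 := by
  have h := abs_lt_sheetRoot (y := y) hγ hx hx'
  have hN := sheetRoot_pos (hγ.trans_lt zero_lt_one) x y
  have := (lt_div_iff₀ hN).2 (show -1 * sheetRoot γ x y < x - y + 2 / 3 * (x + y - 1) by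
    linarith [neg_abs_le (x - y + 2 / 3 * (x + y - 1))])
  rw [sheetSlope]
  linarith

/-- Adding the two hypotheses bounds the numerator below by `(2(x+y-1)² - 3γ)/3`; this is where `γ ≤
0` enters. -/
theorem sheetDensity_pos (hγ : γ ≤ 0) (h₁ : 0 < arcPoly γ x y)
    (h₂ : 0 < arcPoly γ (1 - x) (1 - y)) : 0 < sheetDensity γ x y := by
  have hN := sheetRoot_pos (hγ.trans_lt zero_lt_one) x y
  refine div_pos ?_ (by positivity)
  rw [arcPoly] at h₁ h₂
  nlinarith [sq_nonneg (x + y - 1)]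

/-! ### The distribution functions of the slices -/

/-- The partial derivative of `giniLower γ` in the first variable. -/
noncomputable def sliceCDF (γ x b : ℝ) : ℝ :=
  if b < lowerArc γ x then 0 else if b < upperArc γ x then sheetSlope γ x b else 1

theorem sliceCDF_nonneg (hγ : γ ≤ 0) (hx : 0 ≤ x) (hx' : x ≤ 1) :
    0 ≤ sliceCDF γ x y := by
  unfold sliceCDF
  split_ifs
  · exact le_rfl
  · exact (sheetSlope_pos hγ hx hx').le
  · exact zero_le_one

theorem sliceCDF_le_one (hγ : γ ≤ 0) (hx : 0 ≤ x) (hx' : x ≤ 1) :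
    sliceCDF γ x y ≤ 1 := by
  unfold sliceCDF
  split_ifs
  · exact zero_le_one
  · exact (sheetSlope_lt_one hγ hx hx').le
  · exact le_rfl

theorem measurable_sliceCDF (hγ : γ < 1) (b : ℝ) : Measurable fun x ↦ sliceCDF γ x b := by
  have h₁ := (continuous_lowerArc γ).measurable
  have h₂ := (continuous_upperArc γ).measurable
  have h₃ : Measurable fun x ↦ sheetSlope γ x b :=
    ((continuous_sheetSlope hγ).comp (continuous_id.prodMk continuous_const)).measurable
  exact Measurable.ite (measurableSet_lt measurable_const h₁) measurable_const
    (Measurable.ite (measurableSet_lt measurable_const h₂) h₃ measurable_const)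

theorem hasDerivAt_max_sheet (hγ : γ < 1) {b : ℝ} (hx : 0 < x) (hx' : x < 1) (hb : 0 ≤ b)
    (hb' : b ≤ 1) (h₁ : b ≠ lowerArc γ x) (h₂ : b ≠ upperArc γ x) :
    HasDerivAt (fun x ↦ max (max 0 (x + b - 1)) (sheet γ x b)) (sliceCDF γ x b) x := by
  have hI : ∀ᶠ t in nhds x, t ∈ Set.Ioo (0 : ℝ) 1 := isOpen_Ioo.mem_nhds ⟨hx, hx'⟩
  have hlow := (continuous_lowerArc γ).tendsto x
  have hupp := (continuous_upperArc γ).tendsto x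
  have hLU : lowerArc γ x ≤ upperArc γ x := (lowerArc_le γ x).trans (le_upperArc γ x)
  rw [sliceCDF]
  rcases lt_or_gt_of_ne h₁ with h | h
  · rw [if_pos h]
    refine (hasDerivAt_const x (0 : ℝ)).congr_of_eventuallyEq ?_
    filter_upwards [hI, hlow.eventually (lt_mem_nhds h)] with t ht ht'
    exact max_sheet_of_lt_lowerArc hγ.le ht.1.le hb hb' ht'
  rw [if_neg h.not_gt]
  rcases lt_or_gt_of_ne h₂ with h' | h'
  · rw [if_pos h']
    refine (hasDerivAt_sheet hγ x b).congr_of_eventuallyEq ?_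
    filter_upwards [hI, hlow.eventually (gt_mem_nhds h), hupp.eventually (lt_mem_nhds h')]
      with t ht ht₁ ht₂
    exact max_sheet_of_between hγ.le ht.1.le ht.2.le hb hb' ht₁ ht₂
  · rw [if_neg h'.not_gt]
    refine (((hasDerivAt_id' x).add_const b).sub_const 1).congr_of_eventuallyEq ?_
    filter_upwards [hI, hupp.eventually (gt_mem_nhds h')] with t ht ht'
    exact max_sheet_of_upperArc_lt hγ.le ht.2.le hb hb' ht'

/-- `arcPoly` is symmetric, so solving for `x` at height `b` is the same quadratic and has finitely
many solutions. The fundamental theorem of calculus tolerates these exceptional points. -/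
theorem countable_lowerArc_eq (γ : ℝ) {b : ℝ} (hb' : b ≤ 1) :
    {x : ℝ | 0 ≤ x ∧ b = lowerArc γ x}.Countable := by
  refine Set.Countable.mono (s₂ := {1 - b, 1 + 2 * b - √(3 * (b + 1) ^ 2 - 4 + γ),
    1 + 2 * b + √(3 * (b + 1) ^ 2 - 4 + γ)}) ?_ (Set.toFinite _).countable
  rintro x ⟨hx, h⟩
  simp only [Set.mem_insert_iff, Set.mem_singleton_iff]
  rw [lowerArc] at h
  rcases min_cases (1 + 2 * x - √(3 * (x + 1) ^ 2 - 4 + γ)) (1 - x) with ⟨h₁, h₂⟩ | ⟨h₁, h₂⟩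
  · rw [h₁] at h
    rcases le_or_gt (3 * (x + 1) ^ 2 - 4 + γ) 0 with h₃ | h₃
    · rw [Real.sqrt_eq_zero_of_nonpos h₃] at h h₂
      left
      linarith
    · have hsq := Real.sq_sqrt h₃.le
      have h₄ : √(3 * (x + 1) ^ 2 - 4 + γ) = 1 + 2 * x - b := by linarith
      rw [h₄] at hsq
      have h₅ : (x - (1 + 2 * b)) ^ 2 = 3 * (b + 1) ^ 2 - 4 + γ := by linear_combination hsq
      have h₆ := Real.sqrt_sq_eq_abs (x - (1 + 2 * b))
      rw [h₅] at h₆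
      rcases abs_choice (x - (1 + 2 * b)) with h₇ | h₇ <;> rw [h₇] at h₆
      · right; right; linarith
      · right; left; linarith
  · left; linarith

theorem integral_sliceCDF (hγ : γ ≤ 0) {a b : ℝ} (ha : 0 ≤ a) (ha' : a ≤ 1) (hb : 0 ≤ b)
    (hb' : b ≤ 1) :
    ∫ x in (0 : ℝ)..a, sliceCDF γ x b = max (max 0 (a + b - 1)) (sheet γ a b) := by
  have hγ' : γ < 1 := hγ.trans_lt zero_lt_one
  have hc₁ := countable_lowerArc_eq γ hb'
  have hc₂ := countable_lowerArc_eq γ (b := 1 - b) (by linarith)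
  have hint : IntervalIntegrable (fun x ↦ sliceCDF γ x b) volume 0 a := by
    rw [intervalIntegrable_iff_integrableOn_Ioc_of_le ha]
    refine Measure.integrableOn_of_bounded (M := 1) (by simp)
      (measurable_sliceCDF hγ' b).aestronglyMeasurable ?_
    refine (ae_restrict_mem measurableSet_Ioc).mono fun x hx ↦ ?_
    rw [Real.norm_of_nonneg (sliceCDF_nonneg hγ hx.1.le (hx.2.trans ha'))]
    exact sliceCDF_le_one hγ hx.1.le (hx.2.trans ha')
  have hcont : Continuous fun x ↦ max (max 0 (x + b - 1)) (sheet γ x b) := by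
    have : Continuous fun x ↦ sheet γ x b :=
      (continuous_sheet γ).comp (continuous_id.prodMk continuous_const)
    fun_prop
  rw [integral_eq_of_hasDerivAt_off_countable_of_le
    (fun x ↦ max (max 0 (x + b - 1)) (sheet γ x b)) _ ha
    (hc₁.union (hc₂.preimage (f := fun x : ℝ ↦ 1 - x) fun _ _ h ↦ by simpa using h))
    hcont.continuousOn (fun x hx ↦ ?_) hint]
  · have : sheet γ 0 b ≤ 0 := sheet_le_left hγ'.le 0 b
    rw [max_eq_left (a := (0 : ℝ)) (b := 0 + b - 1) (by linarith), max_eq_left this, sub_zero]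
  · obtain ⟨⟨hx₁, hx₂⟩, hx₃⟩ := hx
    refine hasDerivAt_max_sheet hγ' hx₁ (hx₂.trans_le ha') hb hb' (fun h ↦ hx₃ ?_)
      (fun h ↦ hx₃ ?_)
    · exact Or.inl ⟨hx₁.le, h⟩
    · refine Or.inr ⟨by linarith, ?_⟩
      rw [upperArc] at h
      linarith

end Arcs

section InducedMeasure

/-! ### The measure induced by the infimum -/

variable {γ : ℝ}

/-- The point of the graph of `f` above `x`, with `f` truncated to the unit interval. -/
noncomputable def graphPoint (f : ℝ → ℝ) (x : I) : I × I :=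
  (x, Set.projIcc 0 1 zero_le_one (f x))

/-- The measure on the graph of `f` whose first marginal has density `j`. -/
noncomputable def graphMeasure (f j : ℝ → ℝ) : Measure (I × I) :=
  ((volume : Measure I).withDensity fun x ↦ ENNReal.ofReal (j x)).map (graphPoint f)

section GraphMeasure

variable {f j : ℝ → ℝ}

theorem continuous_graphPoint (hf : Continuous f) : Continuous (graphPoint f) :=
  continuous_id.prodMk (continuous_projIcc.comp (hf.comp continuous_subtype_val))

theorem isClosed_graph (hf : Continuous f) : IsClosed {p : I × I | (p.2 : ℝ) = f p.1} :=
  isClosed_eq (by fun_prop) (by fun_prop)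

theorem graphPoint_snd (hf₁ : ∀ x : I, f x ∈ Set.Icc (0 : ℝ) 1) (x : I) :
    ((graphPoint f x).2 : ℝ) = f x := by
  rw [graphPoint, Set.projIcc_of_mem _ (hf₁ x)]

theorem graphMeasure_Iic_prod_Iic (hf : Continuous f) (hf₁ : ∀ x : I, f x ∈ Set.Icc (0 : ℝ) 1)
    (j : ℝ → ℝ) (a b : I) : graphMeasure f j (Set.Iic a ×ˢ Set.Iic b) =
      ∫⁻ x : I in Set.Iic a, ENNReal.ofReal (if f x ≤ b then j x else 0) := by
  have hm := (continuous_graphPoint hf).measurable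
  have hS : MeasurableSet (Set.Iic a ×ˢ Set.Iic b : Set (I × I)) :=
    measurableSet_Iic.prod measurableSet_Iic
  have hT : MeasurableSet {x : I | f x ≤ b} :=
    measurableSet_le (hf.comp continuous_subtype_val).measurable measurable_const
  have hpre : graphPoint f ⁻¹' (Set.Iic a ×ˢ Set.Iic b) = {x : I | f x ≤ b} ∩ Set.Iic a := by
    ext x
    simp only [Set.mem_preimage, Set.mem_prod, Set.mem_Iic, Set.mem_inter_iff, Set.mem_ofPred_eq,
      ← graphPoint_snd hf₁ x]
    exact and_comm
  rw [graphMeasure, Measure.map_apply hm hS, withDensity_apply _ (hm hS), hpre,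
    ← setLIntegral_indicator hT]
  refine lintegral_congr fun x ↦ ?_
  by_cases h : f x ≤ b
  · rw [Set.indicator_of_mem (by exact h), if_pos h]
  · rw [Set.indicator_of_notMem (by exact h), if_neg h, ENNReal.ofReal_zero]

theorem graphMeasure_compl_graph (hf : Continuous f) (hf₁ : ∀ x : I, f x ∈ Set.Icc (0 : ℝ) 1)
    (j : ℝ → ℝ) : graphMeasure f j {p : I × I | (p.2 : ℝ) = f p.1}ᶜ = 0 := by
  rw [graphMeasure, Measure.map_apply (continuous_graphPoint hf).measurable
    (isClosed_graph hf).measurableSet.compl]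
  refine (congrArg _ ?_).trans measure_empty
  refine Set.eq_empty_of_forall_notMem fun x hx ↦ hx ?_
  exact graphPoint_snd hf₁ x

theorem volume_graph (hf : Continuous f) :
    (volume : Measure (I × I)) {p : I × I | (p.2 : ℝ) = f p.1} = 0 := by
  rw [Measure.volume_eq_prod, Measure.measure_prod_null (isClosed_graph hf).measurableSet]
  refine Filter.Eventually.of_forall fun x ↦ Set.Subsingleton.measure_zero ?_ _
  intro y hy z hz
  exact Subtype.ext (Eq.trans hy (Eq.symm hz))

theorem graphMeasure_mutuallySingular (hf : Continuous f)
    (hf₁ : ∀ x : I, f x ∈ Set.Icc (0 : ℝ) 1) (j : ℝ → ℝ) : graphMeasure f j ⟂ₘ volume :=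
  Measure.MutuallySingular.mk (graphMeasure_compl_graph hf hf₁ j) (volume_graph hf)
    fun p _ ↦ (em (p ∈ {p : I × I | (p.2 : ℝ) = f p.1})).symm

theorem support_graphMeasure (hf : Continuous f) (hf₁ : ∀ x : I, f x ∈ Set.Icc (0 : ℝ) 1)
    (hj : Continuous j) (hj₁ : ∀ x : I, 0 < j x) :
    (graphMeasure f j).support = {p : I × I | (p.2 : ℝ) = f p.1} := by
  have hm := (continuous_graphPoint hf).measurable
  refine Set.Subset.antisymm (Measure.support_subset_of_isClosed (isClosed_graph hf)
    (mem_ae_iff.2 (graphMeasure_compl_graph hf hf₁ j))) ?_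
  rintro ⟨x, y⟩ hp
  have hxy : graphPoint f x = (x, y) :=
    Prod.ext rfl (Subtype.ext ((graphPoint_snd hf₁ x).trans (Eq.symm hp)))
  rw [Measure.mem_support_iff_forall]
  intro U hU
  obtain ⟨V, hVU, hV, hpV⟩ := mem_nhds_iff.1 hU
  have hpre : IsOpen (graphPoint f ⁻¹' V) := hV.preimage (continuous_graphPoint hf)
  refine lt_of_lt_of_le ?_ (measure_mono hVU)
  have hjm : Measurable fun x : I ↦ ENNReal.ofReal (j x) :=
    (hj.comp continuous_subtype_val).measurable.ennreal_ofReal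
  rw [graphMeasure, Measure.map_apply hm hV.measurableSet,
    withDensity_apply _ hpre.measurableSet, setLIntegral_pos_iff hjm]
  have : (Function.support fun x : I ↦ ENNReal.ofReal (j x)) = Set.univ :=
    Set.eq_univ_of_forall fun x ↦ (ENNReal.ofReal_pos.2 (hj₁ x)).ne'
  rw [this, Set.univ_inter]
  exact hpre.measure_pos _ ⟨x, by rwa [Set.mem_preimage, hxy]⟩

end GraphMeasure

theorem setLIntegral_unitInterval_Iic (f : ℝ → ENNReal) (b : I) :
    ∫⁻ y : I in Set.Iic b, f y = ∫⁻ y in Set.Icc (0 : ℝ) b, f y := by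
  rw [← lintegral_indicator measurableSet_Iic]
  have h : ∀ y : I, (Set.Iic b).indicator (fun y : I ↦ f y) y =
      (Set.Iic (b : ℝ)).indicator f y := fun y ↦ by
    by_cases hy : y ≤ b
    · rw [Set.indicator_of_mem (by exact hy), Set.indicator_of_mem (by exact hy)]
    · rw [Set.indicator_of_notMem (by exact hy), Set.indicator_of_notMem (by exact hy)]
  simp only [h]
  refine (lintegral_subtype_comap measurableSet_Icc ((Set.Iic (b : ℝ)).indicator f)).trans ?_
  rw [setLIntegral_indicator measurableSet_Iic]
  congr 2
  ext y
  have := b.2.2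
  simp only [Set.mem_inter_iff, Set.mem_Iic, Set.mem_Icc]
  constructor
  · rintro ⟨h₁, h₂, -⟩
    exact ⟨h₂, h₁⟩
  · rintro ⟨h₁, h₂⟩
    exact ⟨h₂, h₁, h₂.trans this⟩

theorem lowerArc_mem (hγ : γ ≤ 0) (x : I) : lowerArc γ x ∈ Set.Icc (0 : ℝ) 1 :=
  ⟨lowerArc_nonneg hγ x.2.1 x.2.2, (lowerArc_le γ x).trans (by linarith [x.2.1])⟩

theorem upperArc_mem (hγ : γ ≤ 0) (x : I) : upperArc γ x ∈ Set.Icc (0 : ℝ) 1 :=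
  ⟨le_trans (by linarith [x.2.2]) (le_upperArc γ x), upperArc_le_one hγ x.2.1 x.2.2⟩

theorem lowerArc_le_upperArc (γ x : ℝ) : lowerArc γ x ≤ upperArc γ x :=
  (lowerArc_le γ x).trans (le_upperArc γ x)

theorem lintegral_sheetDensity (hγ : γ ≤ 0) {x : ℝ} (hx : 0 ≤ x) (hx' : x ≤ 1) {m : ℝ}
    (h₁ : lowerArc γ x ≤ m) (h₂ : m ≤ upperArc γ x) :
    (∫⁻ y in Set.Ioc (lowerArc γ x) m, ENNReal.ofReal (sheetDensity γ x y)) +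
      ENNReal.ofReal (sheetSlope γ x (lowerArc γ x)) = ENNReal.ofReal (sheetSlope γ x m) := by
  have hγ' : γ < 1 := hγ.trans_lt zero_lt_one
  have hcont : Continuous fun y ↦ sheetDensity γ x y :=
    (continuous_sheetDensity hγ').comp (continuous_const.prodMk continuous_id)
  have hL := lowerArc_nonneg hγ hx hx'
  have hU := upperArc_le_one hγ hx hx'
  have hint : ∫ y in Set.Ioo (lowerArc γ x) m, sheetDensity γ x y =
      sheetSlope γ x m - sheetSlope γ x (lowerArc γ x) := by
    rw [← intervalIntegral.integral_eq_sub_of_hasDerivAt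
      (fun y _ ↦ hasDerivAt_sheetSlope hγ' x y) (hcont.intervalIntegrable _ _),
      intervalIntegral.integral_of_le h₁, restrict_Ioo_eq_restrict_Ioc]
  have hnn : 0 ≤ᵐ[volume.restrict (Set.Ioo (lowerArc γ x) m)] fun y ↦ sheetDensity γ x y := by
    refine (ae_restrict_mem measurableSet_Ioo).mono fun y hy ↦ ?_
    obtain ⟨h₃, h₄⟩ := (between_arcs_iff (γ := γ) hx hx' (hL.trans hy.1.le)
      ((hy.2.le.trans h₂).trans hU)).1 ⟨hy.1, hy.2.trans_le h₂⟩
    exact (sheetDensity_pos hγ h₃ h₄).le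
  rw [← restrict_Ioo_eq_restrict_Ioc, ← ofReal_integral_eq_lintegral_ofReal
    (hcont.integrableOn_Icc.mono_set Set.Ioo_subset_Icc_self) hnn,
    ← ENNReal.ofReal_add (integral_nonneg_of_ae hnn) (sheetSlope_pos hγ hx hx').le, hint,
    sub_add_cancel]

/-- Along a slice the distribution function jumps from 0 to the slope at the lower edge, grows with
the density, and jumps to 1 at the upper edge. Where the edges coincide the two jumps add up to 1.
-/
theorem slice_eq (hγ : γ ≤ 0) (x b : I) :
    (∫⁻ y : I in Set.Iic b, (Set.Ioo (lowerArc γ x) (upperArc γ x)).indicator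
        (fun y ↦ ENNReal.ofReal (sheetDensity γ x y)) (y : ℝ)) +
      (ENNReal.ofReal (if lowerArc γ x ≤ b then sheetSlope γ x (lowerArc γ x) else 0) +
        ENNReal.ofReal (if upperArc γ x ≤ b then 1 - sheetSlope γ x (upperArc γ x) else 0)) =
      ENNReal.ofReal (sliceCDF γ x b) := by
  have hx := x.2.1
  have hx' := x.2.2
  have hL := lowerArc_nonneg hγ hx hx'
  have hU := upperArc_le_one hγ hx hx'
  have hLU := lowerArc_le_upperArc γ x
  have hpos : ∀ y, 0 < sheetSlope γ x y := fun y ↦ sheetSlope_pos hγ hx hx'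
  have hlt : ∀ y, sheetSlope γ x y < 1 := fun y ↦ sheetSlope_lt_one hγ hx hx'
  have hmono : ∀ m, lowerArc γ x ≤ m → m ≤ upperArc γ x →
      (∫⁻ y in Set.Ioc (lowerArc γ x) m, ENNReal.ofReal (sheetDensity γ x y)) +
        ENNReal.ofReal (sheetSlope γ x (lowerArc γ x)) =
      ENNReal.ofReal (sheetSlope γ x m) :=
    fun m ↦ lintegral_sheetDensity hγ hx hx'
  rw [setLIntegral_unitInterval_Iic ((Set.Ioo (lowerArc γ x) (upperArc γ x)).indicator
    (fun y ↦ ENNReal.ofReal (sheetDensity γ x y))) b, setLIntegral_indicator measurableSet_Ioo,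
    sliceCDF]
  rcases lt_or_ge (b : ℝ) (lowerArc γ x) with h | h
  · have he : Set.Ioo (lowerArc γ x) (upperArc γ x) ∩ Set.Icc 0 (b : ℝ) = ∅ := by
      ext y
      simp only [Set.mem_inter_iff, Set.mem_Ioo, Set.mem_Icc, Set.mem_empty_iff_false, iff_false]
      rintro ⟨⟨h₁, -⟩, -, h₂⟩
      linarith
    rw [he, if_neg h.not_ge, if_neg (h.trans_le hLU).not_ge, if_pos h]
    simp
  rw [if_pos h, if_neg h.not_gt]
  rcases lt_or_ge (b : ℝ) (upperArc γ x) with h' | h'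
  · have he : Set.Ioo (lowerArc γ x) (upperArc γ x) ∩ Set.Icc 0 (b : ℝ) =
        Set.Ioc (lowerArc γ x) b := by
      ext y
      simp only [Set.mem_inter_iff, Set.mem_Ioo, Set.mem_Icc, Set.mem_Ioc]
      constructor
      · rintro ⟨⟨h₁, -⟩, -, h₂⟩
        exact ⟨h₁, h₂⟩
      · rintro ⟨h₁, h₂⟩
        exact ⟨⟨h₁, by linarith⟩, by linarith, h₂⟩
    rw [he, if_neg h'.not_ge, if_pos h', ENNReal.ofReal_zero, add_zero, hmono b h h'.le]
  · have he : Set.Ioo (lowerArc γ x) (upperArc γ x) ∩ Set.Icc 0 (b : ℝ) =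
        Set.Ioo (lowerArc γ x) (upperArc γ x) := by
      refine Set.inter_eq_left.2 fun y hy ↦ ⟨hL.trans hy.1.le, hy.2.le.trans h'⟩
    rw [he, setLIntegral_congr Ioo_ae_eq_Ioc, if_pos h', if_neg h'.not_gt, ← add_assoc,
      hmono _ hLU le_rfl, ← ENNReal.ofReal_add (hpos _).le (by linarith [hlt (upperArc γ x)])]
    congr 1
    ring

/-- The continuous component of the measure induced by `giniLower γ`. -/
noncomputable def continuousPart (γ : ℝ) : Measure (I × I) :=
  (volume : Measure (I × I)).withDensity
    ({p : I × I | lowerArc γ p.1 < p.2 ∧ (p.2 : ℝ) < upperArc γ p.1}.indicator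
      fun p ↦ ENNReal.ofReal (sheetDensity γ p.1 p.2))

/-- The part of the measure induced by `giniLower γ` that lives on the two edges. -/
noncomputable def edgePart (γ : ℝ) : Measure (I × I) :=
  graphMeasure (lowerArc γ) (fun x ↦ sheetSlope γ x (lowerArc γ x)) +
    graphMeasure (upperArc γ) (fun x ↦ 1 - sheetSlope γ x (upperArc γ x))

theorem isOpen_between_arcs (γ : ℝ) :
    IsOpen {p : I × I | lowerArc γ p.1 < p.2 ∧ (p.2 : ℝ) < upperArc γ p.1} := by
  have h₁ := continuous_lowerArc γ
  have h₂ := continuous_upperArc γ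
  exact IsOpen.inter (s := {p : I × I | lowerArc γ p.1 < p.2})
    (t := {p : I × I | (p.2 : ℝ) < upperArc γ p.1})
    (isOpen_lt (by fun_prop) (by fun_prop)) (isOpen_lt (by fun_prop) (by fun_prop))

theorem measurable_indicator_sheetDensity (hγ : γ < 1) :
    Measurable ({p : I × I | lowerArc γ p.1 < p.2 ∧ (p.2 : ℝ) < upperArc γ p.1}.indicator
      fun p ↦ ENNReal.ofReal (sheetDensity γ p.1 p.2)) := by
  refine Measurable.indicator ?_ (isOpen_between_arcs γ).measurableSet
  exact ((continuous_sheetDensity hγ).comp (f := fun p : I × I ↦ ((p.1 : ℝ), (p.2 : ℝ)))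
    (by fun_prop)).measurable.ennreal_ofReal

theorem continuous_lowerJump (hγ : γ < 1) : Continuous fun x ↦ sheetSlope γ x (lowerArc γ x) :=
  (continuous_sheetSlope hγ).comp (continuous_id.prodMk (continuous_lowerArc γ))

theorem continuous_upperJump (hγ : γ < 1) :
    Continuous fun x ↦ 1 - sheetSlope γ x (upperArc γ x) :=
  continuous_const.sub
    ((continuous_sheetSlope hγ).comp (continuous_id.prodMk (continuous_upperArc γ)))

theorem edgePart_add_continuousPart_Iic (hγ : γ ≤ 0) (a b : I) :
    (edgePart γ + continuousPart γ) (Set.Iic a ×ˢ Set.Iic b) =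
      ENNReal.ofReal (max (frechetW a b) (sheet γ a b)) := by
  have hγ' : γ < 1 := hγ.trans_lt zero_lt_one
  have hm := measurable_indicator_sheetDensity hγ'
  have hl := (continuous_lowerArc γ).comp (continuous_subtype_val (p := (· ∈ I)))
  have hu := (continuous_upperArc γ).comp (continuous_subtype_val (p := (· ∈ I)))
  have hlj := (continuous_lowerJump hγ').comp (continuous_subtype_val (p := (· ∈ I)))
  have huj := (continuous_upperJump hγ').comp (continuous_subtype_val (p := (· ∈ I)))
  have hm₁ : Measurable fun x : I ↦
      ENNReal.ofReal (if lowerArc γ x ≤ b then sheetSlope γ x (lowerArc γ x) else 0) :=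
    (Measurable.ite (measurableSet_le hl.measurable measurable_const) hlj.measurable
      measurable_const).ennreal_ofReal
  have hm₂ : Measurable fun x : I ↦
      ENNReal.ofReal (if upperArc γ x ≤ b then 1 - sheetSlope γ x (upperArc γ x) else 0) :=
    (Measurable.ite (measurableSet_le hu.measurable measurable_const) huj.measurable
      measurable_const).ennreal_ofReal
  have hm₁₂ : Measurable fun x : I ↦
      ENNReal.ofReal (if lowerArc γ x ≤ b then sheetSlope γ x (lowerArc γ x) else 0) +
      ENNReal.ofReal (if upperArc γ x ≤ b then 1 - sheetSlope γ x (upperArc γ x) else 0) :=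
    hm₁.add hm₂
  have hg : Measurable fun x : ℝ ↦ sliceCDF γ x b := measurable_sliceCDF hγ' b
  have hnn : 0 ≤ᵐ[volume.restrict (Set.Icc (0 : ℝ) a)] fun x ↦ sliceCDF γ x b :=
    (ae_restrict_mem measurableSet_Icc).mono fun x hx ↦
      sliceCDF_nonneg hγ hx.1 (hx.2.trans a.2.2)
  have hint : IntegrableOn (fun x ↦ sliceCDF γ x b) (Set.Icc (0 : ℝ) a) := by
    refine Measure.integrableOn_of_bounded (M := 1) (by simp) hg.aestronglyMeasurable ?_
    filter_upwards [hnn, ae_restrict_mem measurableSet_Icc] with x hx hx'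
    rw [Real.norm_of_nonneg hx]
    exact sliceCDF_le_one hγ hx'.1 (hx'.2.trans a.2.2)
  rw [Measure.add_apply, edgePart, Measure.add_apply, add_comm,
    graphMeasure_Iic_prod_Iic (continuous_lowerArc γ) (lowerArc_mem hγ),
    graphMeasure_Iic_prod_Iic (continuous_upperArc γ) (upperArc_mem hγ), continuousPart,
    withDensity_apply _ (measurableSet_Iic.prod measurableSet_Iic), Measure.volume_eq_prod,
    setLIntegral_prod _ hm.aemeasurable, ← lintegral_add_left hm₁,
    ← lintegral_add_right _ hm₁₂]
  have hslice : ∀ x : I, (∫⁻ y : I in Set.Iic b,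
      {p : I × I | lowerArc γ p.1 < p.2 ∧ (p.2 : ℝ) < upperArc γ p.1}.indicator
        (fun p ↦ ENNReal.ofReal (sheetDensity γ p.1 p.2)) (x, y)) +
      (ENNReal.ofReal (if lowerArc γ x ≤ b then sheetSlope γ x (lowerArc γ x) else 0) +
        ENNReal.ofReal (if upperArc γ x ≤ b then 1 - sheetSlope γ x (upperArc γ x) else 0)) =
      ENNReal.ofReal (sliceCDF γ x b) := fun x ↦ slice_eq hγ x b
  simp only [hslice]
  rw [setLIntegral_unitInterval_Iic fun x ↦ ENNReal.ofReal (sliceCDF γ x b),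
    ← ofReal_integral_eq_lintegral_ofReal hint hnn, integral_Icc_eq_integral_Ioc,
    ← intervalIntegral.integral_of_le a.2.1, integral_sliceCDF hγ a.2.1 a.2.2 b.2.1 b.2.2,
    frechetW]

theorem isCopulaMeasure_giniLower (h₁ : -1 ≤ γ) (hγ : γ ≤ 0) :
    IsCopulaMeasure (giniLower γ) (edgePart γ + continuousPart γ) := fun a b ↦ by
  rw [edgePart_add_continuousPart_Iic hγ, giniLower_eq h₁ hγ]

/-- Inclusion-exclusion for two overlapping lower-left rectangles gives the 2-increasing inequality.
-/
theorem IsQuasiCopula.isCopula_of_isCopulaMeasure {Q : I → I → ℝ} {μ : Measure (I × I)}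
    (hQ : IsQuasiCopula Q) (hμ : IsCopulaMeasure Q μ) : IsCopula Q where
  zero_left := hQ.zero_left
  zero_right := hQ.zero_right
  one_left := hQ.one_left
  one_right := hQ.one_right
  two_increasing a a' b b' ha hb := by
    have h := measure_union_add_inter (μ := μ) (Set.Iic a' ×ˢ Set.Iic b)
      (measurableSet_Iic.prod measurableSet_Iic (α := I) (β := I) (s := Set.Iic a) (t := Set.Iic b'))
    have hsub : (Set.Iic a' ×ˢ Set.Iic b) ∪ (Set.Iic a ×ˢ Set.Iic b') ⊆
        Set.Iic a' ×ˢ Set.Iic b' :=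
      Set.union_subset (Set.prod_mono le_rfl (Set.Iic_subset_Iic.2 hb))
        (Set.prod_mono (Set.Iic_subset_Iic.2 ha) le_rfl)
    rw [Set.prod_inter_prod, Set.Iic_inter_Iic, Set.Iic_inter_Iic, min_eq_right ha,
      min_eq_left hb, hμ, hμ, hμ, ← ENNReal.ofReal_add (hQ.nonneg _ _) (hQ.nonneg _ _)] at h
    have h' : ENNReal.ofReal (Q a' b + Q a b') ≤ ENNReal.ofReal (Q a' b' + Q a b) := by
      rw [← h, ENNReal.ofReal_add (hQ.nonneg _ _) (hQ.nonneg _ _), ← hμ a' b']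
      gcongr
    rw [ENNReal.ofReal_le_ofReal_iff (add_nonneg (hQ.nonneg _ _) (hQ.nonneg _ _))] at h'
    linarith

end InducedMeasure

section Decomposition

/-! ### The Lebesgue decomposition -/

variable {γ : ℝ}

theorem omegaFun_eq (hγ : γ ≤ 1) (a b : ℝ) : omegaFun a (1 - b) (-γ) = a - sheet γ a b := by
  have hE : 5 * (a + (1 - b) - 1) ^ 2 - 2 * (1 - 2 * a) * (1 - 2 * (1 - b)) + 2 * (1 + -γ) =
      3 * sheetRoot γ a b ^ 2 := by
    rw [sheetRoot_sq hγ]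
    ring
  have h₃ : √3 * √3 = (3 : ℝ) := Real.mul_self_sqrt (by norm_num)
  rw [omegaFun, hE, Real.sqrt_mul (by norm_num), Real.sqrt_sq (sheetRoot_nonneg γ a b), sheet]
  linear_combination sheetRoot γ a b / 6 * h₃

theorem mem_hyperbolicRegion_iff (hγ : γ ≤ 1) (p : I × I) :
    p ∈ hyperbolicRegion γ ↔
      0 < sheet γ p.1 p.2 ∧ (p.1 : ℝ) + p.2 - 1 < sheet γ p.1 p.2 := by
  rw [hyperbolicRegion, Set.mem_ofPred_eq, omegaFun_eq hγ]
  constructor <;> rintro ⟨h₁, h₂⟩ <;> constructor <;> linarith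

theorem mem_hyperbolicRegion_iff_arcPoly (hγ : γ ≤ 1) (p : I × I) :
    p ∈ hyperbolicRegion γ ↔
      0 < arcPoly γ p.1 p.2 ∧ 0 < arcPoly γ (1 - p.1) (1 - p.2) := by
  rw [mem_hyperbolicRegion_iff hγ, sheet_pos_iff hγ p.1.2.1 p.2.2.1,
    lt_sheet_iff hγ p.1.2.2 p.2.2.2]

theorem hyperbolicRegion_eq (hγ : γ ≤ 1) : hyperbolicRegion γ =
    {p : I × I | lowerArc γ p.1 < p.2 ∧ (p.2 : ℝ) < upperArc γ p.1} := by
  ext p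
  rw [mem_hyperbolicRegion_iff_arcPoly hγ,
    ← between_arcs_iff p.1.2.1 p.1.2.2 p.2.2.1 p.2.2.2]
  rfl

/-! ### Topology of the hyperbolic region. -/

theorem isOpen_hyperbolicRegion (hγ : γ ≤ 1) : IsOpen (hyperbolicRegion γ) := by
  rw [hyperbolicRegion_eq hγ]
  exact isOpen_between_arcs γ

theorem frontier_hyperbolicRegion_subset (hγ : γ ≤ 1) :
    frontier (hyperbolicRegion γ) ⊆ hyperbola₁ γ ∪ hyperbola₂ γ := by
  have hs : Continuous fun p : I × I ↦ sheet γ p.1 p.2 :=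
    (continuous_sheet γ).comp (f := fun p : I × I ↦ ((p.1 : ℝ), (p.2 : ℝ))) (by fun_prop)
  rw [(isOpen_hyperbolicRegion hγ).frontier_eq]
  rintro p ⟨hp, hp'⟩
  have h₁ : 0 ≤ sheet γ p.1 p.2 :=
    closure_minimal (t := {p : I × I | 0 ≤ sheet γ p.1 p.2})
      (fun q hq ↦ ((mem_hyperbolicRegion_iff hγ q).1 hq).1.le)
      (isClosed_le continuous_const hs) hp
  have h₂ : (p.1 : ℝ) + p.2 - 1 ≤ sheet γ p.1 p.2 :=
    closure_minimal (t := {p : I × I | (p.1 : ℝ) + p.2 - 1 ≤ sheet γ p.1 p.2})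
      (fun q hq ↦ ((mem_hyperbolicRegion_iff hγ q).1 hq).2.le)
      (isClosed_le (by fun_prop) hs) hp
  rw [mem_hyperbolicRegion_iff hγ, not_and_or, not_lt, not_lt] at hp'
  refine hp'.imp (fun h ↦ ?_) fun h ↦ ?_
  · rw [hyperbola₁, Set.mem_ofPred_eq, omegaFun_eq hγ]
    linarith
  · rw [hyperbola₂, Set.mem_ofPred_eq, omegaFun_eq hγ]
    linarith

/-- The region is star-shaped about the centre: along a ray `arcPoly` is a quadratic in `t` with
value `1/2 + γ > 0` at `t = 0`. For `w ≥ 0` it is `t²` times its value at 1 plus nonnegative terms;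
for `w ≤ 0` it is at least its value at 1. -/
theorem arcPoly_segment_pos (hγ : -1 / 2 < γ) {x y t : ℝ} (hs : 0 ≤ x + y) (ht : 0 ≤ t)
    (ht' : t ≤ 1) (h : 0 < arcPoly γ x y) :
    0 < arcPoly γ (1 / 2 + t * (x - 1 / 2)) (1 / 2 + t * (y - 1 / 2)) := by
  set w := x + y - 1 with hw
  set E := 6 * (x - 1 / 2) * (y - 1 / 2) - w ^ 2 with hE
  have hq : arcPoly γ x y = 1 / 2 + γ + 3 * w + E := by
    rw [arcPoly, hE, hw]
    ring
  have hqt : arcPoly γ (1 / 2 + t * (x - 1 / 2)) (1 / 2 + t * (y - 1 / 2)) =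
      1 / 2 + γ + 3 * w * t + E * t ^ 2 := by
    rw [arcPoly, hE, hw]
    ring
  rw [hq] at h
  rw [hqt]
  have ht₁ : 0 ≤ 1 - t := by linarith
  rcases le_total 0 w with hw₀ | hw₀
  · have h₁ : 0 ≤ w * (t * (1 - t)) := by positivity
    rcases ht'.eq_or_lt with rfl | ht''
    · linarith
    · have h₂ : 0 < (1 / 2 + γ) * (1 - t ^ 2) := mul_pos (by linarith) (by nlinarith)
      have h₃ := mul_nonneg h.le (sq_nonneg t)
      nlinarith
  · have hE' : E ≤ w ^ 2 / 2 := by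
      rw [hE, hw]
      nlinarith [sq_nonneg (x - y)]
    have h₁ : 3 * w + E * (1 + t) ≤ 0 := by
      have : E * (1 + t) ≤ w ^ 2 / 2 * 2 := by
        refine (mul_le_mul_of_nonneg_right hE' (by linarith)).trans ?_
        exact mul_le_mul_of_nonneg_left (by linarith) (by positivity)
      nlinarith
    nlinarith [mul_nonneg ht₁ (neg_nonneg.2 h₁)]

theorem isConnected_hyperbolicRegion (hγ : -1 / 2 < γ) (hγ' : γ ≤ 0) :
    IsConnected (hyperbolicRegion γ) := by
  have hγ₁ : γ ≤ 1 := by linarith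
  let m : I := ⟨1 / 2, by norm_num, by norm_num⟩
  have hm : (m : ℝ) = 1 / 2 := rfl
  refine ⟨⟨(m, m), ?_⟩, isPreconnected_of_forall (m, m) fun p hp ↦ ?_⟩
  · rw [mem_hyperbolicRegion_iff_arcPoly hγ₁, hm, arcPoly, arcPoly]
    norm_num
    linarith
  have hmem : ∀ (x t : I), 1 / 2 + (t : ℝ) * (x - 1 / 2) ∈ Set.Icc (0 : ℝ) 1 := by
    intro x t
    have h₁ := mul_nonneg t.2.1 x.2.1
    have h₂ := mul_nonneg t.2.1 (sub_nonneg.2 x.2.2)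
    have h₃ := t.2.2
    constructor <;> linarith
  let φ : I → I × I := fun t ↦ (⟨_, hmem p.1 t⟩, ⟨_, hmem p.2 t⟩)
  have hφ : Continuous φ :=
    (Continuous.subtype_mk (by fun_prop) _).prodMk (Continuous.subtype_mk (by fun_prop) _)
  refine ⟨Set.range φ, ?_, ⟨0, ?_⟩, ⟨1, ?_⟩, isPreconnected_range hφ⟩
  · rintro _ ⟨t, rfl⟩
    obtain ⟨h₁, h₂⟩ := (mem_hyperbolicRegion_iff_arcPoly hγ₁ p).1 hp
    rw [mem_hyperbolicRegion_iff_arcPoly hγ₁]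
    refine ⟨arcPoly_segment_pos hγ (add_nonneg p.1.2.1 p.2.2.1) t.2.1 t.2.2 h₁, ?_⟩
    have := arcPoly_segment_pos hγ (add_nonneg (sub_nonneg.2 p.1.2.2) (sub_nonneg.2 p.2.2.2))
      t.2.1 t.2.2 h₂
    convert this using 1
    simp only [φ]
    ring_nf
  · ext <;> simp [φ, hm]
  · ext <;> simp [φ]

theorem closure_hyperbolicRegion_of_lt (hγ : γ ≤ 0) {p : I × I}
    (h : lowerArc γ p.1 < upperArc γ p.1) (h₁ : lowerArc γ p.1 ≤ p.2)
    (h₂ : (p.2 : ℝ) ≤ upperArc γ p.1) : p ∈ closure (hyperbolicRegion γ) := by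
  let l : I := ⟨lowerArc γ p.1, lowerArc_mem hγ p.1⟩
  let u : I := ⟨upperArc γ p.1, upperArc_mem hγ p.1⟩
  have hlu : l ≠ u := fun h' ↦ h.ne (congrArg Subtype.val h')
  have hp : p.2 ∈ closure (Set.Ioo l u) := by
    rw [closure_Ioo hlu]
    exact ⟨h₁, h₂⟩
  have hc : Continuous fun y : I ↦ (p.1, y) := by fun_prop
  refine closure_mono ?_ (image_closure_subset_closure_image hc ⟨p.2, hp, rfl⟩)
  rintro _ ⟨y, hy, rfl⟩
  rw [hyperbolicRegion_eq (by linarith)]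
  exact hy

/-- Over abscissae where the arcs separate, their graphs bound the region; elsewhere both are the
antidiagonal. -/
theorem frontier_union_antiDiag (hγ : γ ≤ 0) :
    frontier (hyperbolicRegion γ) ∪ (antiDiag \ hyperbolicRegion γ) =
      {p : I × I | (p.2 : ℝ) = lowerArc γ p.1} ∪ {p : I × I | (p.2 : ℝ) = upperArc γ p.1} := by
  have hγ₁ : γ ≤ 1 := by linarith
  have hl := continuous_lowerArc γ
  have hu := continuous_upperArc γ
  rw [(isOpen_hyperbolicRegion hγ₁).frontier_eq]
  ext p
  have hL := lowerArc_le γ p.1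
  have hU := le_upperArc γ p.1
  have hR : p ∈ hyperbolicRegion γ ↔ lowerArc γ p.1 < p.2 ∧ (p.2 : ℝ) < upperArc γ p.1 := by
    rw [hyperbolicRegion_eq hγ₁]
    rfl
  have hA : p ∈ antiDiag ↔ (p.1 : ℝ) + p.2 = 1 := Iff.rfl
  simp only [Set.mem_union, Set.mem_sdiff, hR, hA, Set.mem_ofPred_eq]
  constructor
  · rintro (⟨hp, hp'⟩ | ⟨hp, hp'⟩)
    · have h₁ : lowerArc γ p.1 ≤ p.2 :=
        closure_minimal (t := {p : I × I | lowerArc γ p.1 ≤ p.2})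
          (fun q hq ↦ by rw [hyperbolicRegion_eq hγ₁] at hq; exact hq.1.le)
          (isClosed_le (by fun_prop) (by fun_prop)) hp
      have h₂ : (p.2 : ℝ) ≤ upperArc γ p.1 :=
        closure_minimal (t := {p : I × I | (p.2 : ℝ) ≤ upperArc γ p.1})
          (fun q hq ↦ by rw [hyperbolicRegion_eq hγ₁] at hq; exact hq.2.le)
          (isClosed_le (by fun_prop) (by fun_prop)) hp
      rw [not_and_or, not_lt, not_lt] at hp'
      exact hp'.imp (fun h ↦ h.antisymm h₁) fun h ↦ h₂.antisymm h
    · rw [not_and_or, not_lt, not_lt] at hp'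
      exact hp'.imp (fun h ↦ by linarith) fun h ↦ by linarith
  · intro hp
    rcases (lowerArc_le_upperArc γ p.1).eq_or_lt with h | h
    · right
      rcases hp with hp | hp <;> constructor <;> (try rw [not_and_or]) <;>
        first | linarith | (left; linarith)
    · left
      rcases hp with hp | hp
      · exact ⟨closure_hyperbolicRegion_of_lt hγ h hp.ge (by rw [hp]; exact h.le),
          fun h' ↦ h'.1.ne' hp⟩
      · exact ⟨closure_hyperbolicRegion_of_lt hγ h (by rw [hp]; exact h.le) hp.le,
          fun h' ↦ h'.2.ne hp⟩

/-! ### The two Lebesgue components and their supports. -/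

theorem edgePart_mutuallySingular (hγ : γ ≤ 0) : edgePart γ ⟂ₘ volume :=
  (graphMeasure_mutuallySingular (continuous_lowerArc γ) (lowerArc_mem hγ) _).add_left
    (graphMeasure_mutuallySingular (continuous_upperArc γ) (upperArc_mem hγ) _)

theorem acPart_eq (hγ : γ ≤ 0) : acPart (edgePart γ + continuousPart γ) = continuousPart γ :=
  (withDensity_congr_ae (Measure.eq_rnDeriv (measurable_indicator_sheetDensity (by linarith))
    (edgePart_mutuallySingular hγ) rfl)).symm

theorem singularPart_eq (hγ : γ ≤ 0) :
    (edgePart γ + continuousPart γ).singularPart volume = edgePart γ :=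
  (Measure.eq_singularPart (measurable_indicator_sheetDensity (by linarith))
    (edgePart_mutuallySingular hγ) rfl).symm

theorem continuousPart_compl (hγ : γ ≤ 1) : continuousPart γ (hyperbolicRegion γ)ᶜ = 0 := by
  have ho := isOpen_hyperbolicRegion hγ
  rw [continuousPart, ← hyperbolicRegion_eq hγ, withDensity_apply _ ho.measurableSet.compl,
    setLIntegral_indicator ho.measurableSet, Set.inter_compl_self, setLIntegral_empty]

theorem support_continuousPart (hγ : γ ≤ 0) :
    (continuousPart γ).support = closure (hyperbolicRegion γ) := by
  have hγ₁ : γ ≤ 1 := by linarith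
  have ho := isOpen_hyperbolicRegion hγ₁
  refine Set.Subset.antisymm (Measure.support_subset_of_isClosed isClosed_closure
    (mem_ae_iff.2 (measure_mono_null (Set.compl_subset_compl.2 subset_closure)
      (continuousPart_compl hγ₁)))) fun p hp ↦ ?_
  rw [Measure.mem_support_iff_forall]
  intro U hU
  obtain ⟨V, hVU, hV, hpV⟩ := mem_nhds_iff.1 hU
  refine lt_of_lt_of_le ?_ (measure_mono hVU)
  rw [continuousPart, withDensity_apply _ hV.measurableSet,
    setLIntegral_pos_iff (measurable_indicator_sheetDensity (by linarith)),
    ← hyperbolicRegion_eq hγ₁]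
  have hne : (V ∩ hyperbolicRegion γ).Nonempty := mem_closure_iff.1 hp V hV hpV
  refine ((hV.inter ho).measure_pos volume hne).trans_le (measure_mono fun q hq ↦ ⟨?_, hq.1⟩)
  rw [Function.mem_support, Set.indicator_of_mem hq.2]
  obtain ⟨h₁, h₂⟩ := (mem_hyperbolicRegion_iff_arcPoly hγ₁ q).1 hq.2
  exact (ENNReal.ofReal_pos.2 (sheetDensity_pos hγ h₁ h₂)).ne'

theorem edgePart_compl (hγ : γ ≤ 0) :
    edgePart γ (frontier (hyperbolicRegion γ) ∪ (antiDiag \ hyperbolicRegion γ))ᶜ = 0 := by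
  rw [frontier_union_antiDiag hγ, edgePart, Measure.add_apply, add_eq_zero]
  exact ⟨measure_mono_null (Set.compl_subset_compl.2 Set.subset_union_left)
      (graphMeasure_compl_graph (continuous_lowerArc γ) (lowerArc_mem hγ) _),
    measure_mono_null (Set.compl_subset_compl.2 Set.subset_union_right)
      (graphMeasure_compl_graph (continuous_upperArc γ) (upperArc_mem hγ) _)⟩

theorem support_edgePart (hγ : γ ≤ 0) : (edgePart γ).support =
    frontier (hyperbolicRegion γ) ∪ (antiDiag \ hyperbolicRegion γ) := by
  have hγ₁ : γ < 1 := by linarith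
  rw [frontier_union_antiDiag hγ, edgePart, Measure.support_add,
    support_graphMeasure (continuous_lowerArc γ) (lowerArc_mem hγ) (continuous_lowerJump hγ₁)
      fun x ↦ sheetSlope_pos hγ x.2.1 x.2.2,
    support_graphMeasure (continuous_upperArc γ) (upperArc_mem hγ) (continuous_upperJump hγ₁)
      fun x ↦ sub_pos.2 (sheetSlope_lt_one hγ x.2.1 x.2.2)]

theorem edgePart_ne_zero (hγ : γ ≤ 0) : edgePart γ ≠ 0 := by
  intro h
  have hs := support_edgePart hγ
  rw [h, Measure.support_zero, frontier_union_antiDiag hγ] at hs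
  have : ((0 : I), (⟨_, lowerArc_mem hγ 0⟩ : I)) ∈ (∅ : Set (I × I)) := by
    rw [hs]
    exact Or.inl rfl
  exact this

theorem giniLower_ne_frechetW (h₁ : -1 / 2 < γ) (h₂ : γ ≤ 0) : giniLower γ ≠ frechetW := by
  obtain ⟨⟨p, hp⟩, -⟩ := isConnected_hyperbolicRegion h₁ h₂
  obtain ⟨h₃, h₄⟩ := (mem_hyperbolicRegion_iff (by linarith) p).1 hp
  intro h
  have := congrFun₂ h p.1 p.2
  rw [giniLower_eq (by linarith) h₂, max_eq_left_iff] at this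
  exact this.not_gt (max_lt h₃ h₄)

theorem giniLower_ne_frechetM (h₁ : -1 ≤ γ) (h₂ : γ ≤ 0) : giniLower γ ≠ frechetM := by
  intro h
  rcases h₁.eq_or_lt with rfl | h₁
  · rw [giniLower_eq_frechetW le_rfl (by norm_num)] at h
    have := congrArg giniGamma h
    rw [giniGamma_frechetM, giniGamma_frechetW] at this
    norm_num at this
  · have := giniGamma_giniLower_lt h₁ (by linarith)
    rw [h, giniGamma_frechetM] at this
    linarith

theorem isCopula_giniLower (h₁ : -1 ≤ γ) (h₂ : γ ≤ 0) : IsCopula (giniLower γ) :=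
  (isQuasiCopula_giniLower h₁ (by linarith)).isCopula_of_isCopulaMeasure
    (isCopulaMeasure_giniLower h₁ h₂)

end Decomposition

theorem corollary10 :
    -- (i)
    (giniLower 1 = frechetM ∧ ∀ γ ∈ Set.Icc (-1 : ℝ) (-1 / 2), giniLower γ = frechetW) ∧
    -- (ii)
    (∀ γ ∈ Set.Ioo (0 : ℝ) 1, IsQuasiCopula (giniLower γ) ∧ ¬ IsCopula (giniLower γ)) ∧
    -- (iii)
    (∀ γ ∈ Set.Ioc (-1 / 2 : ℝ) 0,
      IsCopula (giniLower γ) ∧ giniLower γ ≠ frechetW ∧ giniLower γ ≠ frechetM ∧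
      IsConnected (hyperbolicRegion γ) ∧
      frontier (hyperbolicRegion γ) ⊆ hyperbola₁ γ ∪ hyperbola₂ γ ∧
      ∃ μ : Measure (I × I), IsCopulaMeasure (giniLower γ) μ ∧
        acPart μ (hyperbolicRegion γ)ᶜ = 0 ∧
        (acPart μ).support = closure (hyperbolicRegion γ) ∧
        μ.singularPart volume ≠ 0 ∧
        μ.singularPart volume
          (frontier (hyperbolicRegion γ) ∪ (antiDiag \ hyperbolicRegion γ))ᶜ = 0 ∧
        (μ.singularPart volume).support =
          frontier (hyperbolicRegion γ) ∪ (antiDiag \ hyperbolicRegion γ)) ∧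
    -- (iv)
    (∀ γ ∈ Set.Icc (-1 : ℝ) 1, ∀ γ' ∈ Set.Icc (-1 : ℝ) 1, γ ≤ γ' →
      ConcordanceLE (giniLower γ) (giniLower γ')) ∧
    -- (v)
    (∀ γ ∈ Set.Icc (-1 : ℝ) 1,
      (∀ a b, giniLower γ a b = giniLower γ b a) ∧ survival (giniLower γ) = giniLower γ) ∧
    -- (vi)
    (∀ γ ∈ Set.Ioo (-1 : ℝ) 1, giniGamma (giniLower γ) < γ) := by
  refine ⟨⟨giniLower_one, fun γ hγ ↦ giniLower_eq_frechetW hγ.1 hγ.2⟩,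
    fun γ hγ ↦ ⟨isQuasiCopula_giniLower (by linarith [hγ.1]) hγ.2.le,
      not_isCopula_giniLower hγ.1 hγ.2⟩, fun γ ⟨h₁, h₂⟩ ↦ ?_,
    fun γ hγ γ' hγ' h ↦ concordanceLE_giniLower hγ.1 h hγ'.2,
    fun γ hγ ↦ ⟨giniLower_swap hγ.1 hγ.2, survival_giniLower hγ.1 hγ.2⟩,
    fun γ hγ ↦ giniGamma_giniLower_lt hγ.1 hγ.2⟩
  have h₀ : -1 ≤ γ := by linarith
  refine ⟨isCopula_giniLower h₀ h₂, giniLower_ne_frechetW h₁ h₂, giniLower_ne_frechetM h₀ h₂,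
    isConnected_hyperbolicRegion h₁ h₂, frontier_hyperbolicRegion_subset (by linarith),
    edgePart γ + continuousPart γ, isCopulaMeasure_giniLower h₀ h₂, ?_⟩
  rw [acPart_eq h₂, singularPart_eq h₂]
  exact ⟨continuousPart_compl (by linarith), support_continuousPart h₂, edgePart_ne_zero h₂,
    edgePart_compl h₂, support_edgePart h₂⟩
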